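/- Let $1\le q\le n+1$ and let $\mathbb R^{n+1}_q$ be $\mathbb R^{n+1}$ with coordinates $(x^0,\dots,x^n)$, flat connection $\overline\nabla$ and metric $\overline g=\sum_{i=0}^n\varepsilon_i(dx^i)^2$, where $\varepsilon_i=-1$ for $i\le q-1$ and $\varepsilon_i=+1$ for $i\ge q$. Let $\mathcal D\subset\mathbb R^n$ be open, $F:\mathcal D\to\mathbb R$ smooth, and let $M$ be the graph $x^0=F(u^1,\dots,u^n)$, $x^a=u^a$. Assume $M$ is a null hypersurface, i.e. the induced metric $g$ is degenerate at every point. Write $F_a=\partial F/\partial u^a$ and put on $\mathbb R\times\mathcal D$ $$\mathcal N_F=\tfrac1{\sqrt2}\Big[-\tfrac{\partial}{\partial x^0}+\sum_{a=1}^n\varepsilon_aF_a\tfrac{\partial}{\partial x^a}\Big].$$ Then $\mathcal N_F$ is a null rigging for $M$ (smooth near $M$; transversal to $M$ and lightlike along $M$). Put $\overline\eta=\overline g(\mathcal N_F,\cdot)$ and let $\eta$ be its pullback to $M$. The rigged vector field, i.e. the unique field $\xi$ in the radical of $g$ with $\eta(\xi)=1$, is $\xi_F=\tfrac1{\sqrt2}\big[\tfrac{\partial}{\partial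 x^0}+\sum_a\varepsilon_aF_a\tfrac{\partial}{\partial x^a}\big]$. Let $\mathcal S=\ker\eta$ be the screen distribution, $\nabla$ the connection induced on $M$ by projecting $\overline\nabla$ onto $TM$ along $\mathcal N_F$, $-A_{\mathcal N_F}X$ the $TM$-component of $\overline\nabla_X\mathcal N_F$ along $\mathcal N_F$, $-\overset{\star}{A}_{\xi_F}X$ the $\mathcal S$-component of $\nabla_X\xi_F$ along $\xi_F$, and $\tau(X)=\overline g(\overline\nabla_X\mathcal N_F,\xi_F)$. Then: 1. The rigging is closed: $d\overline\eta=0$ on $\mathbb R\times\mathcal D$ and $d\eta=0$ on $M$. Moreover $\tau\equiv0$. 2. The screen distribution is conformal with factor $1$: $A_{\mathcal N_F}=\overset{\star}{A}_{\xi_F}$. 3. The screen distribution is integrable (it is involutive, and an $(n-1)$-dimensional integral manifold passes through every point). Identifying $M$ with $\mathcal D$, every level set of $F$ is an embedded $(n-1)$-dimensional integral manifold of $\mathcal S$ (possibly empty or disconnected), and the leaves of $\mathcal S$ (the maximal connected integral manifolds) are exactly the connected components of the nonempty level sets of $F$. 4. $g_1=g+\eta\otimes\eta$ is a smooth nondegenerate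 metric on $M$, and $\nabla$ is its Levi-Civita connection. 5. For every smooth vector field $X=\sum_aX^a\frac{\partial}{\partial u^a}$ on $M$, the divergence with respect to $\nabla$ is $\operatorname{div}X:=\operatorname{tr}(Y\mapsto\nabla_YX)=\sum_{a=1}^n\frac{\partial X^a}{\partial u^a}$. -/

import Mathlib

open Set
open scoped ContDiff Manifold

noncomputable section

/-! ### Semi-Euclidean space -/

/-- The sign of the `i`-th coordinate, `-1` for the first `q` coordinates and `+1` afterwards. -/
def semiSign (q i : ℕ) : ℝ := if i < q then -1 else 1

/-- The canonical metric of index `q` on `ℝ^m`. -/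
def semiEuclid (q m : ℕ) : (Fin m → ℝ) →L[ℝ] (Fin m → ℝ) →L[ℝ] ℝ :=
  ∑ i : Fin m, semiSign q i •
    (ContinuousLinearMap.proj (R := ℝ) (φ := fun _ : Fin m => ℝ) i).smulRight
      (ContinuousLinearMap.proj (R := ℝ) (φ := fun _ : Fin m => ℝ) i)

theorem semiEuclid_apply (q m : ℕ) (v w : Fin m → ℝ) :
    semiEuclid q m v w = ∑ i : Fin m, semiSign q i * (v i * w i) := by
  simp [semiEuclid]

/-! ### Rigged null hypersurfaces of semi-Euclidean space

A hypersurface is given by a global parametrization `f`, restricted to an open set `D` of `ℝ^n`.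
Tangent vectors of the hypersurface at `f p` are written in the natural basis `∂/∂u^a`, that is,
`v : Fin n → ℝ` stands for `fderiv ℝ f p v`. Vector fields of the ambient space along the
hypersurface are maps from `ℝ^n` to `ℝ^(n+1)`, and the flat ambient connection differentiates
them componentwise. -/

/-- The pulled back metric `g`. -/
def inducedMetric (q : ℕ) {n : ℕ} (f : (Fin n → ℝ) → (Fin (n + 1) → ℝ)) (p v w : Fin n → ℝ) : ℝ :=
  semiEuclid q (n + 1) (fderiv ℝ f p v) (fderiv ℝ f p w)

/-- The pulled back metric is degenerate at every point. -/
def IsNullHypersurface (q : ℕ) {n : ℕ} (D : Set (Fin n → ℝ))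
    (f : (Fin n → ℝ) → (Fin (n + 1) → ℝ)) : Prop :=
  ∀ p ∈ D, ∃ v : Fin n → ℝ, v ≠ 0 ∧ ∀ w, inducedMetric q f p v w = 0

/-- `L` is a vector field on an open neighbourhood `U` of the hypersurface that is transversal to
the hypersurface and lightlike along it. -/
structure IsNullRigging (q : ℕ) {n : ℕ} (D : Set (Fin n → ℝ))
    (f : (Fin n → ℝ) → (Fin (n + 1) → ℝ)) (U : Set (Fin (n + 1) → ℝ))
    (L : (Fin (n + 1) → ℝ) → (Fin (n + 1) → ℝ)) : Prop where
  isOpen : IsOpen U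
  mapsTo : MapsTo f D U
  smooth : ContDiffOn ℝ ∞ L U
  lightlike : ∀ p ∈ D, semiEuclid q (n + 1) (L (f p)) (L (f p)) = 0
  transversal : ∀ p ∈ D, ∀ v : Fin n → ℝ, fderiv ℝ f p v ≠ L (f p)

/-- The one-form metrically equivalent to an ambient vector field. -/
def flatForm (q : ℕ) {m : ℕ} (L : (Fin m → ℝ) → (Fin m → ℝ)) (y : Fin m → ℝ) :
    (Fin m → ℝ) →L[ℝ] ℝ :=
  semiEuclid q m (L y)

/-- The one-form `η` on the hypersurface: the pullback of the one-form metrically equivalent to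
the rigging. -/
def rigForm (q : ℕ) {n : ℕ} (f N : (Fin n → ℝ) → (Fin (n + 1) → ℝ)) (p : Fin n → ℝ) :
    (Fin n → ℝ) →L[ℝ] ℝ :=
  (semiEuclid q (n + 1) (N p)).comp (fderiv ℝ f p)

/-- A one-form is closed on `U`: its exterior derivative vanishes there. -/
def IsClosedOneForm {m : ℕ} (U : Set (Fin m → ℝ)) (θ : (Fin m → ℝ) → (Fin m → ℝ) →L[ℝ] ℝ) : Prop :=
  ∀ p ∈ U, extDeriv (fun y =>
    ContinuousAlternatingMap.ofSubsingleton ℝ (Fin m → ℝ) ℝ (0 : Fin 1) (θ y)) p = 0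

/-- `ξ` is the rigged vector field: at each point the unique vector of the radical with `η = 1`. -/
structure IsRiggedField (q : ℕ) {n : ℕ} (D : Set (Fin n → ℝ))
    (f N : (Fin n → ℝ) → (Fin (n + 1) → ℝ)) (ξ : (Fin n → ℝ) → (Fin n → ℝ)) : Prop where
  smooth : ContDiffOn ℝ ∞ ξ D
  spec : ∀ p ∈ D, ∀ v : Fin n → ℝ,
    ((∀ w, inducedMetric q f p v w = 0) ∧ rigForm q f N p v = 1) ↔ v = ξ p

/-- The screen distribution `ker η`. -/
def screen (q : ℕ) {n : ℕ} (f N : (Fin n → ℝ) → (Fin (n + 1) → ℝ)) (p : Fin n → ℝ) :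
    Submodule ℝ (Fin n → ℝ) :=
  (rigForm q f N p).ker

/-- The decomposition of an ambient vector at `f p` as `fderiv ℝ f p v + c • N p`. When `N` is
transversal to the hypersurface, this is the inverse of the isomorphism `(v, c) ↦ df v + c N`. -/
def rigSplit {n : ℕ} (f N : (Fin n → ℝ) → (Fin (n + 1) → ℝ)) (p : Fin n → ℝ) :
    (Fin (n + 1) → ℝ) →L[ℝ] (Fin n → ℝ) × ℝ :=
  ContinuousLinearMap.inverse
    ((fderiv ℝ f p).coprod ((1 : ℝ →L[ℝ] ℝ).smulRight (N p)))

/-- For a tangent vector field `Y`, the endomorphism `v ↦ ∇_v Y`, where `∇` is the induced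
connection: the tangential part, along the rigging, of the ambient derivative. -/
def inducedCov {n : ℕ} (f N : (Fin n → ℝ) → (Fin (n + 1) → ℝ)) (Y : (Fin n → ℝ) → (Fin n → ℝ))
    (p : Fin n → ℝ) : (Fin n → ℝ) →L[ℝ] (Fin n → ℝ) :=
  (ContinuousLinearMap.fst ℝ (Fin n → ℝ) ℝ).comp
    ((rigSplit f N p).comp (fderiv ℝ (fun u => fderiv ℝ f u (Y u)) p))

/-- The induced connection `∇_X Y`. -/
def inducedConn {n : ℕ} (f N : (Fin n → ℝ) → (Fin (n + 1) → ℝ))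
    (X Y : (Fin n → ℝ) → (Fin n → ℝ)) (p : Fin n → ℝ) : Fin n → ℝ :=
  inducedCov f N Y p (X p)

/-- The divergence with respect to the induced connection, the trace of `v ↦ ∇_v X`. -/
def inducedDiv {n : ℕ} (f N : (Fin n → ℝ) → (Fin (n + 1) → ℝ))
    (X : (Fin n → ℝ) → (Fin n → ℝ)) (p : Fin n → ℝ) : ℝ :=
  LinearMap.trace ℝ (Fin n → ℝ) (inducedCov f N X p).toLinearMap

/-- The shape operator `A_N`: minus the tangential part of the ambient derivative of `N`. -/
def shapeN {n : ℕ} (f N : (Fin n → ℝ) → (Fin (n + 1) → ℝ)) (p v : Fin n → ℝ) : Fin n → ℝ :=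
  -(rigSplit f N p (fderiv ℝ N p v)).1

/-- The rotation one-form `τ`. -/
def rotationForm (q : ℕ) {n : ℕ} (f N : (Fin n → ℝ) → (Fin (n + 1) → ℝ))
    (ξ : (Fin n → ℝ) → (Fin n → ℝ)) (p v : Fin n → ℝ) : ℝ :=
  semiEuclid q (n + 1) (fderiv ℝ N p v) (fderiv ℝ f p (ξ p))

/-- The projection of a tangent vector onto the screen along `ξ`. -/
def screenProj (q : ℕ) {n : ℕ} (f N : (Fin n → ℝ) → (Fin (n + 1) → ℝ))
    (ξ : (Fin n → ℝ) → (Fin n → ℝ)) (p v : Fin n → ℝ) : Fin n → ℝ :=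
  v - rigForm q f N p v • ξ p

/-- The shape operator of the screen: minus the screen part of `∇_v ξ`. -/
def shapeScreen (q : ℕ) {n : ℕ} (f N : (Fin n → ℝ) → (Fin (n + 1) → ℝ))
    (ξ : (Fin n → ℝ) → (Fin n → ℝ)) (p v : Fin n → ℝ) : Fin n → ℝ :=
  -screenProj q f N ξ p (inducedCov f N ξ p v)

/-- The screen is conformal with conformal factor `φ`. -/
structure HasConformalScreen (q : ℕ) {n : ℕ} (D : Set (Fin n → ℝ))
    (f N : (Fin n → ℝ) → (Fin (n + 1) → ℝ)) (ξ : (Fin n → ℝ) → (Fin n → ℝ))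
    (φ : (Fin n → ℝ) → ℝ) : Prop where
  smooth : ContDiffOn ℝ ∞ φ D
  ne_zero : ∀ p ∈ D, φ p ≠ 0
  eq : ∀ p ∈ D, ∀ v, shapeN f N p v = φ p • shapeScreen q f N ξ p v

/-- The associated metric `g_1 = g + η ⊗ η`. -/
def associatedMetric (q : ℕ) {n : ℕ} (f N : (Fin n → ℝ) → (Fin (n + 1) → ℝ))
    (p v w : Fin n → ℝ) : ℝ :=
  inducedMetric q f p v w + rigForm q f N p v * rigForm q f N p w

/-! ### Levi-Civita connections on open subsets of `ℝ^n` -/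

/-- `∇` is an affine connection on `D`. -/
structure IsAffineConnection {n : ℕ} (D : Set (Fin n → ℝ))
    (nabla : ((Fin n → ℝ) → (Fin n → ℝ)) → ((Fin n → ℝ) → (Fin n → ℝ)) →
      (Fin n → ℝ) → (Fin n → ℝ)) : Prop where
  smooth : ∀ X Y, ContDiffOn ℝ ∞ X D → ContDiffOn ℝ ∞ Y D → ContDiffOn ℝ ∞ (nabla X Y) D
  add_left : ∀ X X' Y, ContDiffOn ℝ ∞ X D → ContDiffOn ℝ ∞ X' D → ContDiffOn ℝ ∞ Y D →
    ∀ p ∈ D, nabla (fun u => X u + X' u) Y p = nabla X Y p + nabla X' Y p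
  smul_left : ∀ (φ : (Fin n → ℝ) → ℝ) (X Y), ContDiffOn ℝ ∞ φ D → ContDiffOn ℝ ∞ X D →
    ContDiffOn ℝ ∞ Y D → ∀ p ∈ D, nabla (fun u => φ u • X u) Y p = φ p • nabla X Y p
  add_right : ∀ X Y Y', ContDiffOn ℝ ∞ X D → ContDiffOn ℝ ∞ Y D → ContDiffOn ℝ ∞ Y' D →
    ∀ p ∈ D, nabla X (fun u => Y u + Y' u) p = nabla X Y p + nabla X Y' p
  leibniz : ∀ (φ : (Fin n → ℝ) → ℝ) (X Y), ContDiffOn ℝ ∞ φ D → ContDiffOn ℝ ∞ X D →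
    ContDiffOn ℝ ∞ Y D → ∀ p ∈ D,
      nabla X (fun u => φ u • Y u) p = φ p • nabla X Y p + fderiv ℝ φ p (X p) • Y p

/-- `g` is a smooth field of symmetric nondegenerate bilinear forms on `D`. -/
structure IsSemiRiemannianMetric {n : ℕ} (D : Set (Fin n → ℝ))
    (g : (Fin n → ℝ) → (Fin n → ℝ) → (Fin n → ℝ) → ℝ) : Prop where
  smooth : ∀ v w, ContDiffOn ℝ ∞ (fun p => g p v w) D
  add : ∀ p ∈ D, ∀ v v' w, g p (v + v') w = g p v w + g p v' w
  smul : ∀ p ∈ D, ∀ (c : ℝ) (v w), g p (c • v) w = c * g p v w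
  symm : ∀ p ∈ D, ∀ v w, g p v w = g p w v
  nondegenerate : ∀ p ∈ D, ∀ v, (∀ w, g p v w = 0) → v = 0

/-- `∇` is the Levi-Civita connection of the metric `g` on `D`: it is an affine connection which
is torsion-free and compatible with `g`. -/
structure IsLeviCivita {n : ℕ} (D : Set (Fin n → ℝ))
    (g : (Fin n → ℝ) → (Fin n → ℝ) → (Fin n → ℝ) → ℝ)
    (nabla : ((Fin n → ℝ) → (Fin n → ℝ)) → ((Fin n → ℝ) → (Fin n → ℝ)) →
      (Fin n → ℝ) → (Fin n → ℝ)) : Prop where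
  metric : IsSemiRiemannianMetric D g
  connection : IsAffineConnection D nabla
  torsionFree : ∀ X Y, ContDiffOn ℝ ∞ X D → ContDiffOn ℝ ∞ Y D → ∀ p ∈ D,
    nabla X Y p - nabla Y X p = VectorField.lieBracket ℝ X Y p
  compatible : ∀ X Y Z, ContDiffOn ℝ ∞ X D → ContDiffOn ℝ ∞ Y D → ContDiffOn ℝ ∞ Z D → ∀ p ∈ D,
    fderiv ℝ (fun u => g u (Y u) (Z u)) p (X p) =
      g p (nabla X Y p) (Z p) + g p (Y p) (nabla X Z p)

/-! ### Distributions, integral manifolds and leaves -/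

/-- `ι` is an injective immersion of the `k`-dimensional manifold `P` into `D` whose tangent spaces
are exactly the spaces of the distribution `S`. -/
structure IsIntegralImmersion {n : ℕ} (D : Set (Fin n → ℝ))
    (S : (Fin n → ℝ) → Submodule ℝ (Fin n → ℝ)) (k : ℕ) {P : Type} [TopologicalSpace P]
    [ChartedSpace (EuclideanSpace ℝ (Fin k)) P] (ι : P → (Fin n → ℝ)) : Prop where
  smooth : ContMDiff (𝓡 k) 𝓘(ℝ, Fin n → ℝ) ∞ ι
  injective : Function.Injective ι
  mem : ∀ y, ι y ∈ D
  immersion : ∀ y, Function.Injective (mfderiv (𝓡 k) 𝓘(ℝ, Fin n → ℝ) ι y)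
  tangent : ∀ y, ∀ w : Fin n → ℝ,
    w ∈ S (ι y) ↔ ∃ v, mfderiv (𝓡 k) 𝓘(ℝ, Fin n → ℝ) ι y v = w

/-- `L` is a connected (immersed) `k`-dimensional integral manifold of `S` in `D`. -/
def IsConnectedIntegralManifold {n : ℕ} (D : Set (Fin n → ℝ))
    (S : (Fin n → ℝ) → Submodule ℝ (Fin n → ℝ)) (k : ℕ) (L : Set (Fin n → ℝ)) : Prop :=
  ∃ (P : Type) (_ : TopologicalSpace P) (_ : T2Space P) (_ : SecondCountableTopology P)
    (_ : ConnectedSpace P) (_ : ChartedSpace (EuclideanSpace ℝ (Fin k)) P)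
    (_ : IsManifold (𝓡 k) ∞ P) (ι : P → (Fin n → ℝ)),
    IsIntegralImmersion D S k ι ∧ range ι = L

/-- `L` is an embedded (possibly disconnected) `k`-dimensional integral manifold of `S` in `D`. -/
def IsEmbeddedIntegralManifold {n : ℕ} (D : Set (Fin n → ℝ))
    (S : (Fin n → ℝ) → Submodule ℝ (Fin n → ℝ)) (k : ℕ) (L : Set (Fin n → ℝ)) : Prop :=
  ∃ (P : Type) (_ : TopologicalSpace P) (_ : T2Space P) (_ : SecondCountableTopology P)
    (_ : ChartedSpace (EuclideanSpace ℝ (Fin k)) P)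
    (_ : IsManifold (𝓡 k) ∞ P) (ι : P → (Fin n → ℝ)),
    IsIntegralImmersion D S k ι ∧ Topology.IsEmbedding ι ∧ range ι = L

/-- The `k`-dimensional distribution `S` is integrable on `D`: there is an integral manifold
through every point. -/
def IsIntegrable {n : ℕ} (D : Set (Fin n → ℝ))
    (S : (Fin n → ℝ) → Submodule ℝ (Fin n → ℝ)) (k : ℕ) : Prop :=
  ∀ p ∈ D, ∃ L, p ∈ L ∧ IsConnectedIntegralManifold D S k L

/-- The distribution `S` is involutive on `D`: its sections are closed under the Lie bracket. -/
def IsInvolutive {n : ℕ} (D : Set (Fin n → ℝ))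
    (S : (Fin n → ℝ) → Submodule ℝ (Fin n → ℝ)) : Prop :=
  ∀ X Y : (Fin n → ℝ) → (Fin n → ℝ), ContDiffOn ℝ ∞ X D → ContDiffOn ℝ ∞ Y D →
    (∀ p ∈ D, X p ∈ S p) → (∀ p ∈ D, Y p ∈ S p) →
    ∀ p ∈ D, VectorField.lieBracket ℝ X Y p ∈ S p

/-- The leaves of `S`: the maximal connected integral manifolds. -/
def IsLeaf {n : ℕ} (D : Set (Fin n → ℝ))
    (S : (Fin n → ℝ) → Submodule ℝ (Fin n → ℝ)) (k : ℕ) (L : Set (Fin n → ℝ)) : Prop :=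
  IsConnectedIntegralManifold D S k L ∧
    ∀ L', IsConnectedIntegralManifold D S k L' → L ⊆ L' → L' = L

/-! ### Monge hypersurfaces -/

/-- The partial derivative of `F` in the direction `u^a`. -/
def pd {n : ℕ} (F : (Fin n → ℝ) → ℝ) (a : Fin n) (u : Fin n → ℝ) : ℝ :=
  fderiv ℝ F u (Pi.single a 1)

/-- The graph parametrization `u ↦ (F u, u)`. -/
def mongeMap {n : ℕ} (F : (Fin n → ℝ) → ℝ) (u : Fin n → ℝ) : Fin (n + 1) → ℝ :=
  Fin.cons (F u) u

/-- The rigging `(1/√2) (-∂/∂x^0 + ε^a F_a ∂/∂x^a)`, a vector field on `ℝ × D`, constant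
in `x^0`. -/
def mongeRigging (q : ℕ) {n : ℕ} (F : (Fin n → ℝ) → ℝ) (y : Fin (n + 1) → ℝ) : Fin (n + 1) → ℝ :=
  (1 / √2) • (Fin.cons (-1) (fun a : Fin n => semiSign q (a + 1) * pd F a (Fin.tail y)) :
    Fin (n + 1) → ℝ)

/-- The rigging along the hypersurface. -/
def mongeRig (q : ℕ) {n : ℕ} (F : (Fin n → ℝ) → ℝ) (u : Fin n → ℝ) : Fin (n + 1) → ℝ :=
  mongeRigging q F (mongeMap F u)

/-- The vector field `(1/√2) ε^a F_a ∂/∂u^a` on the hypersurface; its image in the ambient space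
is `(1/√2) (∂/∂x^0 + ε^a F_a ∂/∂x^a)` when the hypersurface is null. -/
def mongeRigged (q : ℕ) {n : ℕ} (F : (Fin n → ℝ) → ℝ) (u : Fin n → ℝ) : Fin n → ℝ :=
  fun a => (1 / √2) * (semiSign q (a + 1) * pd F a u)

end

/-! Everything rests on one scalar identity. Let `G = signedGrad q F` be the gradient of `F` for the
spatial part of the metric. A radical vector of the graph metric must be a multiple of `G`, and
applying `dF` turns this into the eikonal equation `dF(G) = 1` (`fderiv_signedGrad_of_degenerate`).
Differentiating it, with `G` metrically dual to `dF`, gives `Hess F(v, G) = 0` for all `v`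
(`hessian_signedGrad`).

The rest is explicit. Solving the linear system that splits a vector along the rigging
(`rigSplit_mongeMap`) gives `∇_X Y = D_X Y + (Hess F(X, Y) / 2) G`, where `D` is the flat
derivative. The terms that could spoil `τ = 0`, the equality of the shape operators and the
coordinate formula for the divergence are all multiples of `Hess F(·, G)`. Since `η = √2 dF`, the
associated metric is `dF ⊗ dF` plus the spatial form, and the `G`-term of `∇` is what compatibility
with it requires.

The screen is `ker dF`, and `dF` never vanishes by the eikonal equation. Level sets are therefore
embedded integral manifolds. Conversely `F` is constant on every connected integral manifold, so
maximality identifies the leaves with the components of the level sets. -/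

theorem semiSign_mul_self (q i : ℕ) : semiSign q i * semiSign q i = 1 := by
  unfold semiSign; split_ifs <;> norm_num

/-! ### Algebra of the spatial form. -/

/-- The metric of `ℝ^(n+1)_q` restricted to the hyperplane `x^0 = 0`. -/
noncomputable def spatialForm (q : ℕ) {n : ℕ} (v w : Fin n → ℝ) : ℝ :=
  ∑ a : Fin n, semiSign q (a + 1) * (v a * w a)

/-- The field `ε^a F_a ∂/∂u^a`. -/
noncomputable def signedGrad (q : ℕ) {n : ℕ} (F : (Fin n → ℝ) → ℝ) (u : Fin n → ℝ) : Fin n → ℝ :=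
  fun a => semiSign q (a + 1) * pd F a u

theorem mongeRigged_eq (q : ℕ) {n : ℕ} (F : (Fin n → ℝ) → ℝ) (u : Fin n → ℝ) :
    mongeRigged q F u = (1 / √2) • signedGrad q F u := rfl

theorem mongeRig_eq (q : ℕ) {n : ℕ} (F : (Fin n → ℝ) → ℝ) (u : Fin n → ℝ) :
    mongeRig q F u = (1 / √2) • (Fin.cons (-1) (signedGrad q F u) : Fin (n + 1) → ℝ) := rfl

theorem semiEuclid_cons {q : ℕ} (hq : 1 ≤ q) {n : ℕ} (a b : ℝ) (v w : Fin n → ℝ) :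
    semiEuclid q (n + 1) (Fin.cons a v) (Fin.cons b w) = -(a * b) + spatialForm q v w := by
  rw [semiEuclid_apply, Fin.sum_univ_succ]
  have h0 : semiSign q 0 = -1 := by simp [semiSign]; omega
  simp [h0, spatialForm]

theorem spatialForm_comm (q : ℕ) {n : ℕ} (v w : Fin n → ℝ) :
    spatialForm q v w = spatialForm q w v := by
  simp only [spatialForm, mul_comm (v _)]

theorem spatialForm_add_left (q : ℕ) {n : ℕ} (v v' w : Fin n → ℝ) :
    spatialForm q (v + v') w = spatialForm q v w + spatialForm q v' w := by
  simp only [spatialForm, ← Finset.sum_add_distrib, Pi.add_apply]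
  exact Finset.sum_congr rfl fun a _ => by ring

theorem spatialForm_smul_left (q : ℕ) {n : ℕ} (c : ℝ) (v w : Fin n → ℝ) :
    spatialForm q (c • v) w = c * spatialForm q v w := by
  simp only [spatialForm, Finset.mul_sum, Pi.smul_apply, smul_eq_mul]
  exact Finset.sum_congr rfl fun a _ => by ring

theorem spatialForm_smul_right (q : ℕ) {n : ℕ} (c : ℝ) (v w : Fin n → ℝ) :
    spatialForm q v (c • w) = c * spatialForm q v w := by
  rw [spatialForm_comm, spatialForm_smul_left, spatialForm_comm]

theorem spatialForm_single (q : ℕ) {n : ℕ} (v : Fin n → ℝ) (a : Fin n) :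
    spatialForm q v (Pi.single a 1) = semiSign q (a + 1) * v a := by
  rw [spatialForm, Finset.sum_eq_single a]
  · simp
  · intro b _ hb; simp [hb]
  · simp

theorem clm_apply_eq_sum {n : ℕ} (T : (Fin n → ℝ) →L[ℝ] ℝ) (v : Fin n → ℝ) :
    T v = ∑ a, v a * T (Pi.single a 1) := by
  conv_lhs => rw [pi_eq_sum_univ' v]
  simp only [map_sum, map_smul, smul_eq_mul]

/-- The signs in the form and in `signedGrad` multiply to `1`, so `signedGrad` is the metric
gradient of `F`. -/
theorem fderiv_eq_spatialForm (q : ℕ) {n : ℕ} (F : (Fin n → ℝ) → ℝ) (p v : Fin n → ℝ) :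
    fderiv ℝ F p v = spatialForm q (signedGrad q F p) v := by
  rw [clm_apply_eq_sum]
  refine Finset.sum_congr rfl fun a _ => ?_
  have := semiSign_mul_self q (a + 1)
  simp only [signedGrad, pd]
  linear_combination (-(v a * fderiv ℝ F p (Pi.single a 1))) * this

/-! ### First-order geometry of the graph and the splitting along the rigging. -/

section Calculus

variable {n : ℕ} {F : (Fin n → ℝ) → ℝ} {p : Fin n → ℝ}

theorem hasFDerivAt_cons {f : (Fin n → ℝ) → ℝ} {Y : (Fin n → ℝ) → (Fin n → ℝ)}
    (hf : DifferentiableAt ℝ f p) (hY : DifferentiableAt ℝ Y p) :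
    HasFDerivAt (fun u => (Fin.cons (f u) (Y u) : Fin (n + 1) → ℝ))
      (ContinuousLinearMap.pi (Fin.cons (fderiv ℝ f p) (fun a =>
        (ContinuousLinearMap.proj (R := ℝ) (φ := fun _ : Fin n => ℝ) a).comp (fderiv ℝ Y p))))
      p := by
  rw [hasFDerivAt_pi']
  intro i
  refine Fin.cases ?_ (fun a => ?_) i
  · exact hf.hasFDerivAt
  · exact hasFDerivAt_pi'.1 hY.hasFDerivAt a

theorem fderiv_cons {f : (Fin n → ℝ) → ℝ} {Y : (Fin n → ℝ) → (Fin n → ℝ)}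
    (hf : DifferentiableAt ℝ f p) (hY : DifferentiableAt ℝ Y p) (v : Fin n → ℝ) :
    fderiv ℝ (fun u => (Fin.cons (f u) (Y u) : Fin (n + 1) → ℝ)) p v =
      Fin.cons (fderiv ℝ f p v) (fderiv ℝ Y p v) := by
  rw [(hasFDerivAt_cons hf hY).fderiv]
  ext i
  refine Fin.cases ?_ (fun a => ?_) i <;> simp

theorem fderiv_mongeMap (hF : DifferentiableAt ℝ F p) (v : Fin n → ℝ) :
    fderiv ℝ (mongeMap F) p v = Fin.cons (fderiv ℝ F p v) v := by
  have := fderiv_cons hF (differentiableAt_id (𝕜 := ℝ) (x := p)) v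
  rwa [fderiv_id] at this

theorem inducedMetric_mongeMap {q : ℕ} (hq : 1 ≤ q) (hF : DifferentiableAt ℝ F p)
    (v w : Fin n → ℝ) : inducedMetric q (mongeMap F) p v w =
      -(fderiv ℝ F p v * fderiv ℝ F p w) + spatialForm q v w := by
  rw [inducedMetric, fderiv_mongeMap hF, fderiv_mongeMap hF, semiEuclid_cons hq]

theorem two_div_sqrt_two : 2 / √2 = √2 := by
  rw [div_eq_iff (by positivity)]; exact (Real.mul_self_sqrt (by norm_num)).symm

/-- The `x^0` part and the spatial part each contribute `dF / √2`. -/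
theorem rigForm_mongeMap {q : ℕ} (hq : 1 ≤ q) (hF : DifferentiableAt ℝ F p) (v : Fin n → ℝ) :
    rigForm q (mongeMap F) (mongeRig q F) p v = √2 * fderiv ℝ F p v := by
  rw [rigForm, ContinuousLinearMap.comp_apply, fderiv_mongeMap hF, mongeRig_eq, map_smul,
    smul_apply, semiEuclid_cons hq, ← fderiv_eq_spatialForm, smul_eq_mul]
  linear_combination (fderiv ℝ F p v) * two_div_sqrt_two

/-- A graph with degenerate induced metric satisfies the eikonal equation. -/
theorem fderiv_signedGrad_of_degenerate {q : ℕ} (hq : 1 ≤ q) (hF : DifferentiableAt ℝ F p)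
    (h : ∃ v : Fin n → ℝ, v ≠ 0 ∧ ∀ w, inducedMetric q (mongeMap F) p v w = 0) :
    fderiv ℝ F p (signedGrad q F p) = 1 := by
  obtain ⟨v, hv, h⟩ := h
  -- Pairing the radical vector with each basis vector determines its coordinates.
  have hv' : v = fderiv ℝ F p v • signedGrad q F p := by
    ext a
    have := h (Pi.single a 1)
    rw [inducedMetric_mongeMap hq hF, spatialForm_single] at this
    have hs := semiSign_mul_self q (a + 1)
    simp only [Pi.smul_apply, smul_eq_mul, signedGrad, pd]
    linear_combination semiSign q (a + 1) * this - v a * hs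
  have hne : fderiv ℝ F p v ≠ 0 := fun h0 => hv (by rw [hv', h0, zero_smul])
  have := congrArg (fderiv ℝ F p) hv'
  rw [map_smul, smul_eq_mul] at this
  exact mul_left_cancel₀ hne (by rw [mul_one]; exact this.symm)

/-- The system is `a = dF(v) - c/√2`, `w = v + (c/√2) G`. Applying `dF` to the second equation and
subtracting the first gives `dF(w) - a = √2 c`, hence `c`, and then `v`. -/
theorem rigSplit_mongeMap {q : ℕ} (hF : DifferentiableAt ℝ F p)
    (hE : fderiv ℝ F p (signedGrad q F p) = 1) (a : ℝ) (w : Fin n → ℝ) :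
    rigSplit (mongeMap F) (mongeRig q F) p (Fin.cons a w) =
      (w - ((fderiv ℝ F p w - a) / 2) • signedGrad q F p, (fderiv ℝ F p w - a) / √2) := by
  set T := (fderiv ℝ (mongeMap F) p).coprod
    ((1 : ℝ →L[ℝ] ℝ).smulRight (mongeRig q F p)) with hT
  have hTa : ∀ v c, T (v, c) = Fin.cons (fderiv ℝ F p v - c / √2)
      (v + (c / √2) • signedGrad q F p) := by
    intro v c
    rw [hT, ContinuousLinearMap.coprod_apply, fderiv_mongeMap hF, mongeRig_eq]
    ext i
    refine Fin.cases ?_ (fun a => ?_) i <;> simp <;> ring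
  have h2 : √2 * √2 = 2 := Real.mul_self_sqrt (by norm_num)
  have hinj : Function.Injective T := by
    rw [injective_iff_map_eq_zero]
    rintro ⟨v, c⟩ h
    rw [hTa] at h
    have h0 : fderiv ℝ F p v - c / √2 = 0 := congrFun h 0
    have h1 : v + (c / √2) • signedGrad q F p = 0 := by
      ext a; exact congrFun h a.succ
    have h3 := congrArg (fderiv ℝ F p) h1
    simp only [map_add, map_smul, hE, smul_eq_mul, mul_one, map_zero] at h3
    have h4 : c / √2 = 0 := by linarith
    rw [h4, zero_smul, add_zero] at h1
    have : c = 0 := by simpa using h4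
    rw [h1, this]; rfl
  have hfin : Module.finrank ℝ ((Fin n → ℝ) × ℝ) = Module.finrank ℝ (Fin (n + 1) → ℝ) := by
    simp
  -- `ContinuousLinearMap.inverse` is `0` on a non-invertible map, so `T` has to be exhibited as an
  -- equivalence.
  let e : ((Fin n → ℝ) × ℝ) ≃L[ℝ] (Fin (n + 1) → ℝ) :=
    (LinearEquiv.ofInjectiveOfFinrankEq T.toLinearMap hinj hfin).toContinuousLinearEquiv
  have he : (e : ((Fin n → ℝ) × ℝ) →L[ℝ] (Fin (n + 1) → ℝ)) = T := by ext <;> rfl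
  rw [rigSplit, ← hT, ← he, ContinuousLinearMap.inverse_equiv]
  rw [ContinuousLinearEquiv.coe_coe, ContinuousLinearEquiv.symm_apply_eq]
  change _ = T _
  rw [hTa]
  have h5 : (fderiv ℝ F p w - a) / √2 / √2 = (fderiv ℝ F p w - a) / 2 := by
    rw [div_div, h2]
  rw [h5]
  congr 1
  · simp only [map_sub, map_smul, hE, smul_eq_mul]; ring
  · simp

end Calculus

/-! ### The Hessian of `F`, the induced connection and the shape operators. -/

section SecondOrder

variable {n : ℕ} {F : (Fin n → ℝ) → ℝ} {p : Fin n → ℝ}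

theorem ContDiffAt.eventually_differentiableAt_infty (hF : ContDiffAt ℝ ∞ F p) :
    ∀ᶠ u in nhds p, DifferentiableAt ℝ F u :=
  ((hF.of_le (m := 1) (by norm_cast)).eventually (by simp)).mono
    fun _ h => h.differentiableAt (by simp)

theorem ContDiffAt.fderiv_infty {E G : Type*} [NormedAddCommGroup E] [NormedSpace ℝ E]
    [NormedAddCommGroup G] [NormedSpace ℝ G] {f : E → G} {x : E} (hf : ContDiffAt ℝ ∞ f x) :
    ContDiffAt ℝ ∞ (fderiv ℝ f) x :=
  hf.fderiv_right (by simp)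

theorem ContDiffAt.signedGrad (q : ℕ) (hF : ContDiffAt ℝ ∞ F p) :
    ContDiffAt ℝ ∞ (signedGrad q F) p := by
  rw [contDiffAt_pi]
  intro a
  exact contDiffAt_const.mul (hF.fderiv_infty.clm_apply contDiffAt_const)

theorem hessian_comm (hF : ContDiffAt ℝ ∞ F p) (v w : Fin n → ℝ) :
    fderiv ℝ (fderiv ℝ F) p v w = fderiv ℝ (fderiv ℝ F) p w v :=
  hF.isSymmSndFDerivAt (by simpa using ENat.LEInfty.out) v w

theorem fderiv_fderiv_apply (hF : ContDiffAt ℝ ∞ F p) {Y : (Fin n → ℝ) → (Fin n → ℝ)}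
    (hY : DifferentiableAt ℝ Y p) (v : Fin n → ℝ) :
    fderiv ℝ (fun u => fderiv ℝ F u (Y u)) p v =
      fderiv ℝ (fderiv ℝ F) p v (Y p) + fderiv ℝ F p (fderiv ℝ Y p v) := by
  rw [fderiv_clm_apply (hF.fderiv_infty.differentiableAt (by simp)) hY]
  simp [add_comm]

theorem fderiv_signedGrad (q : ℕ) (hF : ContDiffAt ℝ ∞ F p) (v : Fin n → ℝ) :
    fderiv ℝ (signedGrad q F) p v =
      fun a : Fin n => semiSign q (a + 1) * fderiv ℝ (fderiv ℝ F) p v (Pi.single a 1) := by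
  have hd := hF.fderiv_infty.differentiableAt (by simp)
  have : HasFDerivAt (signedGrad q F) (ContinuousLinearMap.pi fun a : Fin n =>
      semiSign q (a + 1) • ((fderiv ℝ (fderiv ℝ F) p).flip (Pi.single a 1))) p := by
    rw [hasFDerivAt_pi]
    intro a
    exact ((hd.hasFDerivAt.clm_apply (hasFDerivAt_const (Pi.single a (1 : ℝ)) p)).congr_fderiv
      (f' := _) (g' := (fderiv ℝ (fderiv ℝ F) p).flip (Pi.single a 1)) (by ext; simp)).const_mul _
  rw [this.fderiv]
  ext a; simp

theorem spatialForm_fderiv_signedGrad (q : ℕ) (hF : ContDiffAt ℝ ∞ F p) (v w : Fin n → ℝ) :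
    spatialForm q (fderiv ℝ (signedGrad q F) p v) w = fderiv ℝ (fderiv ℝ F) p v w := by
  rw [fderiv_signedGrad q hF, clm_apply_eq_sum (fderiv ℝ (fderiv ℝ F) p v), spatialForm]
  refine Finset.sum_congr rfl fun a _ => ?_
  linear_combination (w a * fderiv ℝ (fderiv ℝ F) p v (Pi.single a 1)) *
    semiSign_mul_self q (a + 1)

theorem fderiv_apply_fderiv_signedGrad (q : ℕ) (hF : ContDiffAt ℝ ∞ F p) (v : Fin n → ℝ) :
    fderiv ℝ F p (fderiv ℝ (signedGrad q F) p v) =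
      fderiv ℝ (fderiv ℝ F) p v (signedGrad q F p) := by
  rw [fderiv_eq_spatialForm q, spatialForm_comm, spatialForm_fderiv_signedGrad q hF]

/-- The derivative of `dF(G) = 1` along `v` is `Hess F(v, G) + dF(D_v G)`, and by duality the two
summands are equal. -/
theorem hessian_signedGrad {q : ℕ} (hF : ContDiffAt ℝ ∞ F p)
    (hE : ∀ᶠ u in nhds p, fderiv ℝ F u (signedGrad q F u) = 1) (v : Fin n → ℝ) :
    fderiv ℝ (fderiv ℝ F) p v (signedGrad q F p) = 0 := by
  have h := fderiv_fderiv_apply hF ((hF.signedGrad q).differentiableAt (by simp)) v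
  have h0 : fderiv ℝ (fun u => fderiv ℝ F u (signedGrad q F u)) p = 0 := by
    rw [Filter.EventuallyEq.fderiv_eq (f := fun _ => (1 : ℝ)) hE]; simp
  rw [h0, fderiv_apply_fderiv_signedGrad q hF] at h
  simp only [zero_apply] at h
  linarith

/-- The ambient derivative of `(dF(Y), Y)` differs from the tangent vector over `D_v Y` only by
`Hess F(v, Y)` in the `x^0` slot; splitting that off leaves half of it along `G`. -/
theorem inducedCov_mongeMap {q : ℕ} (hF : ContDiffAt ℝ ∞ F p)
    (hE : fderiv ℝ F p (signedGrad q F p) = 1) {Y : (Fin n → ℝ) → (Fin n → ℝ)}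
    (hY : DifferentiableAt ℝ Y p) (v : Fin n → ℝ) :
    inducedCov (mongeMap F) (mongeRig q F) Y p v =
      fderiv ℝ Y p v + (fderiv ℝ (fderiv ℝ F) p v (Y p) / 2) • signedGrad q F p := by
  have hd := hF.fderiv_infty.differentiableAt (by simp)
  have h1 : (fun u => fderiv ℝ (mongeMap F) u (Y u)) =ᶠ[nhds p]
      fun u => (Fin.cons (fderiv ℝ F u (Y u)) (Y u) : Fin (n + 1) → ℝ) :=
    hF.eventually_differentiableAt_infty.mono fun u hu => fderiv_mongeMap hu _
  have h2 : fderiv ℝ (fun u => fderiv ℝ (mongeMap F) u (Y u)) p v =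
      Fin.cons (fderiv ℝ (fderiv ℝ F) p v (Y p) + fderiv ℝ F p (fderiv ℝ Y p v))
        (fderiv ℝ Y p v) := by
    rw [h1.fderiv_eq, ← fderiv_fderiv_apply hF hY]
    exact fderiv_cons (hd.clm_apply hY) hY v
  rw [inducedCov, ContinuousLinearMap.comp_apply, ContinuousLinearMap.comp_apply, h2,
    rigSplit_mongeMap (hF.differentiableAt (by simp)) hE]
  simp only [ContinuousLinearMap.coe_fst']
  rw [sub_eq_add_neg, ← neg_smul]
  congr 2
  ring

theorem fderiv_mongeRig (q : ℕ) (hF : ContDiffAt ℝ ∞ F p) (v : Fin n → ℝ) :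
    fderiv ℝ (mongeRig q F) p v =
      (1 / √2) • (Fin.cons 0 (fderiv ℝ (signedGrad q F) p v) : Fin (n + 1) → ℝ) := by
  have hG := (hF.signedGrad q).differentiableAt (by simp)
  have hc : DifferentiableAt ℝ (fun _ : Fin n → ℝ => (-1 : ℝ)) p := differentiableAt_const _
  have h := (hasFDerivAt_cons hc hG).differentiableAt.hasFDerivAt.const_smul (1 / √2)
  change HasFDerivAt (mongeRig q F) _ p at h
  rw [h.fderiv, smul_apply, fderiv_cons hc hG]
  simp

theorem fderiv_mongeRigged (q : ℕ) (hF : ContDiffAt ℝ ∞ F p) (v : Fin n → ℝ) :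
    fderiv ℝ (mongeRigged q F) p v = (1 / √2) • fderiv ℝ (signedGrad q F) p v := by
  have hG := (hF.signedGrad q).differentiableAt (by simp)
  have h := hG.hasFDerivAt.const_smul (1 / √2)
  change HasFDerivAt (mongeRigged q F) _ p at h
  rw [h.fderiv]; rfl

/-- The derivative of the rigging is `(0, D_v G) / √2`. It is already tangent, since `dF(D_v G) =
Hess F(v, G) = 0`. -/
theorem shapeN_mongeMap {q : ℕ} (hF : ContDiffAt ℝ ∞ F p)
    (hE : ∀ᶠ u in nhds p, fderiv ℝ F u (signedGrad q F u) = 1) (v : Fin n → ℝ) :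
    shapeN (mongeMap F) (mongeRig q F) p v =
      -((1 / √2) • fderiv ℝ (signedGrad q F) p v) := by
  rw [shapeN, fderiv_mongeRig q hF, map_smul,
    rigSplit_mongeMap (hF.differentiableAt (by simp)) hE.self_of_nhds,
    fderiv_apply_fderiv_signedGrad q hF, hessian_signedGrad hF hE]
  simp

/-- Both corrections vanish: the connection term is a multiple of `Hess F(v, G)`, and so is the
`η`-component removed by the projection. -/
theorem shapeScreen_mongeMap {q : ℕ} (hq : 1 ≤ q) (hF : ContDiffAt ℝ ∞ F p)
    (hE : ∀ᶠ u in nhds p, fderiv ℝ F u (signedGrad q F u) = 1) (v : Fin n → ℝ) :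
    shapeScreen q (mongeMap F) (mongeRig q F) (mongeRigged q F) p v =
      -((1 / √2) • fderiv ℝ (signedGrad q F) p v) := by
  have hG : DifferentiableAt ℝ (mongeRigged q F) p :=
    ((hF.signedGrad q).differentiableAt (by simp)).const_smul (1 / √2)
  have h := hessian_signedGrad hF hE v
  rw [shapeScreen, screenProj, rigForm_mongeMap hq (hF.differentiableAt (by simp)),
    inducedCov_mongeMap hF hE.self_of_nhds hG, fderiv_mongeRigged q hF, mongeRigged_eq,
    map_smul, h, map_add, map_smul, map_smul, fderiv_apply_fderiv_signedGrad q hF, h]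
  simp

theorem rotationForm_mongeMap {q : ℕ} (hq : 1 ≤ q) (hF : ContDiffAt ℝ ∞ F p)
    (hE : ∀ᶠ u in nhds p, fderiv ℝ F u (signedGrad q F u) = 1) (v : Fin n → ℝ) :
    rotationForm q (mongeMap F) (mongeRig q F) (mongeRigged q F) p v = 0 := by
  rw [rotationForm, fderiv_mongeRig q hF, fderiv_mongeMap (hF.differentiableAt (by simp)),
    map_smul, smul_apply, semiEuclid_cons hq, mongeRigged_eq, spatialForm_smul_right,
    spatialForm_fderiv_signedGrad q hF, hessian_signedGrad hF hE]
  simp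

/-- The correction to the flat derivative is the rank-one map `v ↦ (Hess F(v, X) / 2) G`, whose
trace `Hess F(G, X) / 2` is zero. -/
theorem inducedDiv_mongeMap {q : ℕ} (hF : ContDiffAt ℝ ∞ F p)
    (hE : ∀ᶠ u in nhds p, fderiv ℝ F u (signedGrad q F u) = 1)
    {X : (Fin n → ℝ) → (Fin n → ℝ)} (hX : DifferentiableAt ℝ X p) :
    inducedDiv (mongeMap F) (mongeRig q F) X p = ∑ a : Fin n, pd (fun u => X u a) a p := by
  have h : ∀ a : Fin n, inducedCov (mongeMap F) (mongeRig q F) X p (Pi.single a 1) a =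
      pd (fun u => X u a) a p +
        1 / 2 * (signedGrad q F p a * fderiv ℝ (fderiv ℝ F) p (X p) (Pi.single a 1)) := by
    intro a
    have hc : fderiv ℝ (fun u => X u a) p =
        (ContinuousLinearMap.proj (R := ℝ) (φ := fun _ : Fin n => ℝ) a).comp (fderiv ℝ X p) :=
      (hasFDerivAt_pi'.1 hX.hasFDerivAt a).fderiv
    rw [inducedCov_mongeMap hF hE.self_of_nhds hX, pd, hc, hessian_comm hF]
    simp only [Pi.add_apply, Pi.smul_apply, smul_eq_mul, ContinuousLinearMap.comp_apply,
      ContinuousLinearMap.proj_apply]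
    ring
  rw [inducedDiv, LinearMap.trace_eq_matrix_trace ℝ (Pi.basisFun ℝ (Fin n)), Matrix.trace]
  simp only [Matrix.diag_apply, LinearMap.toMatrix_apply, Pi.basisFun_apply, Pi.basisFun_repr,
    ContinuousLinearMap.coe_coe, h]
  rw [Finset.sum_add_distrib, ← Finset.mul_sum, ← clm_apply_eq_sum, hessian_signedGrad hF hE]
  simp

theorem associatedMetric_mongeMap {q : ℕ} (hq : 1 ≤ q) (hF : DifferentiableAt ℝ F p)
    (v w : Fin n → ℝ) : associatedMetric q (mongeMap F) (mongeRig q F) p v w =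
      fderiv ℝ F p v * fderiv ℝ F p w + spatialForm q v w := by
  rw [associatedMetric, inducedMetric_mongeMap hq hF, rigForm_mongeMap hq hF,
    rigForm_mongeMap hq hF]
  have h2 : √2 * √2 = 2 := Real.mul_self_sqrt (by norm_num)
  linear_combination (fderiv ℝ F p v * fderiv ℝ F p w) * h2

/-- Exact forms are closed: `G` is viewed as a `0`-form and `d ∘ d = 0` applies. -/
theorem isClosedOneForm_of_eqOn_fderiv {m : ℕ} {U : Set (Fin m → ℝ)} (hU : IsOpen U)
    {θ : (Fin m → ℝ) → (Fin m → ℝ) →L[ℝ] ℝ} {G : (Fin m → ℝ) → ℝ} (hG : ContDiffOn ℝ ∞ G U)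
    (h : EqOn θ (fderiv ℝ G) U) : IsClosedOneForm U θ := by
  intro p hp
  have h1 : (fun y => ContinuousAlternatingMap.ofSubsingleton ℝ (Fin m → ℝ) ℝ (0 : Fin 1) (θ y))
      =ᶠ[nhds p] extDeriv (fun x => ContinuousAlternatingMap.constOfIsEmpty ℝ (Fin m → ℝ)
        (Fin 0) (G x)) := by
    filter_upwards [hU.mem_nhds hp] with y hy
    rw [extDeriv_constOfIsEmpty, h hy]
  rw [h1.extDeriv_eq]
  refine extDeriv_extDeriv_apply (r := ∞) ?_ (by simpa using ENat.LEInfty.out)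
  exact (ContinuousAlternatingMap.constOfIsEmptyLIE ℝ (Fin m → ℝ) ℝ
    (Fin 0)).contDiff.contDiffAt.comp p (hG.contDiffAt (hU.mem_nhds hp))

end SecondOrder

/-! ### The rigging, the associated metric and its Levi-Civita connection. -/

section Monge

variable {n q : ℕ} {D : Set (Fin n → ℝ)} {F : (Fin n → ℝ) → ℝ}

/-- `F` satisfies the eikonal equation `∑ ε^a F_a^2 = 1` on `D`. -/
def IsEikonal (q : ℕ) {n : ℕ} (D : Set (Fin n → ℝ)) (F : (Fin n → ℝ) → ℝ) : Prop :=
  ∀ p ∈ D, fderiv ℝ F p (signedGrad q F p) = 1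

theorem IsNullHypersurface.isEikonal (hq : 1 ≤ q) (hD : IsOpen D) (hF : ContDiffOn ℝ ∞ F D)
    (hnull : IsNullHypersurface q D (mongeMap F)) : IsEikonal q D F := fun p hp =>
  fderiv_signedGrad_of_degenerate hq
    ((hF.contDiffAt (hD.mem_nhds hp)).differentiableAt (by simp)) (hnull p hp)

theorem IsEikonal.eventually (hE : IsEikonal q D F) (hD : IsOpen D) {p : Fin n → ℝ}
    (hp : p ∈ D) : ∀ᶠ u in nhds p, fderiv ℝ F u (signedGrad q F u) = 1 := by
  filter_upwards [hD.mem_nhds hp] with u hu using hE u hu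

theorem contDiff_tail : ContDiff ℝ ∞ (Fin.tail : (Fin (n + 1) → ℝ) → (Fin n → ℝ)) := by
  rw [contDiff_pi]
  exact fun a => contDiff_apply ℝ ℝ a.succ

theorem isOpen_tail_preimage (hD : IsOpen D) : IsOpen {y : Fin (n + 1) → ℝ | Fin.tail y ∈ D} :=
  hD.preimage contDiff_tail.continuous

theorem contDiffOn_signedGrad (hD : IsOpen D) (hF : ContDiffOn ℝ ∞ F D) :
    ContDiffOn ℝ ∞ (signedGrad q F) D := fun _ hp =>
  ((hF.contDiffAt (hD.mem_nhds hp)).signedGrad q).contDiffWithinAt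

theorem isNullRigging_mongeRigging (hq : 1 ≤ q) (hD : IsOpen D) (hF : ContDiffOn ℝ ∞ F D)
    (hE : IsEikonal q D F) :
    IsNullRigging q D (mongeMap F) {y | Fin.tail y ∈ D} (mongeRigging q F) where
  isOpen := isOpen_tail_preimage hD
  mapsTo p hp := by simpa [mongeMap] using hp
  smooth := by
    have h : ContDiffOn ℝ ∞ (fun y : Fin (n + 1) → ℝ => signedGrad q F (Fin.tail y))
        {y | Fin.tail y ∈ D} :=
      (contDiffOn_signedGrad hD hF).comp contDiff_tail.contDiffOn fun _ h => h
    refine ContDiffOn.const_smul (1 / √2) ?_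
    rw [contDiffOn_pi] at h ⊢
    intro i
    refine Fin.cases ?_ (fun a => ?_) i
    · exact contDiffOn_const
    · exact h a
  lightlike p hp := by
    change semiEuclid q (n + 1) (mongeRig q F p) (mongeRig q F p) = 0
    rw [mongeRig_eq, map_smul, map_smul, smul_apply, semiEuclid_cons hq,
      ← fderiv_eq_spatialForm, hE p hp]
    simp
  transversal p hp v h := by
    have hd := (hF.contDiffAt (hD.mem_nhds hp)).differentiableAt (by simp)
    change _ = mongeRig q F p at h
    rw [fderiv_mongeMap hd, mongeRig_eq] at h
    -- If the rigging were tangent, `dF(v)` would be `-1/√2` by the `x^0` component and `1/√2` by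
    -- the eikonal equation.
    have h0 : fderiv ℝ F p v = 1 / √2 * -1 := congrFun h 0
    have h1 : v = (1 / √2) • signedGrad q F p := by ext a; exact congrFun h a.succ
    rw [h1, map_smul, hE p hp, smul_eq_mul] at h0
    have : 0 < 1 / √2 := by positivity
    linarith

theorem isRiggedField_mongeRigged (hq : 1 ≤ q) (hD : IsOpen D) (hF : ContDiffOn ℝ ∞ F D)
    (hE : IsEikonal q D F) :
    IsRiggedField q D (mongeMap F) (mongeRig q F) (mongeRigged q F) where
  smooth := (contDiffOn_signedGrad hD hF).const_smul (1 / √2)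
  spec p hp v := by
    have hd := (hF.contDiffAt (hD.mem_nhds hp)).differentiableAt (by simp)
    simp only [inducedMetric_mongeMap hq hd, rigForm_mongeMap hq hd, mongeRigged_eq]
    have h2 : √2 ≠ 0 := by positivity
    constructor
    · rintro ⟨h, h1⟩
      have h3 : fderiv ℝ F p v = 1 / √2 := by rw [eq_div_iff h2]; linarith
      rw [← h3]
      ext a
      have := h (Pi.single a 1)
      rw [spatialForm_single] at this
      simp only [Pi.smul_apply, smul_eq_mul, signedGrad, pd]
      linear_combination semiSign q (a + 1) * this - v a * semiSign_mul_self q (a + 1)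
    · rintro rfl
      refine ⟨fun w => ?_, ?_⟩
      · rw [spatialForm_smul_left, ← fderiv_eq_spatialForm, map_smul, hE p hp, smul_eq_mul]
        ring
      · rw [map_smul, hE p hp, smul_eq_mul]
        field_simp

theorem fderiv_mongeMap_mongeRigged {p : Fin n → ℝ} (hd : DifferentiableAt ℝ F p)
    (hE : fderiv ℝ F p (signedGrad q F p) = 1) :
    fderiv ℝ (mongeMap F) p (mongeRigged q F p) =
        (1 / √2) • (Fin.cons 1 (fun a : Fin n => semiSign q (a + 1) * pd F a p) :
          Fin (n + 1) → ℝ) := by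
  rw [mongeRigged_eq, map_smul, fderiv_mongeMap hd, hE]; rfl

theorem isClosedOneForm_flatForm (hq : 1 ≤ q) (hD : IsOpen D) (hF : ContDiffOn ℝ ∞ F D) :
    IsClosedOneForm {y | Fin.tail y ∈ D} (flatForm q (mongeRigging q F)) := by
  have hF' : ContDiffOn ℝ ∞ (fun y : Fin (n + 1) → ℝ => F (Fin.tail y)) {y | Fin.tail y ∈ D} :=
    hF.comp contDiff_tail.contDiffOn fun _ h => h
  refine isClosedOneForm_of_eqOn_fderiv (isOpen_tail_preimage hD)
    -- Pairing the rigging with `(a, v)` gives `(a + dF(v)) / √2`, which suggests this primitive.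
    (G := fun y => (1 / √2) • (y 0 + F (Fin.tail y)))
    (((contDiff_apply ℝ ℝ 0).contDiffOn.add hF').const_smul (1 / √2)) fun y hy => ?_
  have hd := (hF.contDiffAt (hD.mem_nhds hy)).differentiableAt (by simp)
  have ht : HasFDerivAt (Fin.tail : (Fin (n + 1) → ℝ) → (Fin n → ℝ)) (ContinuousLinearMap.pi
      fun a : Fin n => ContinuousLinearMap.proj (R := ℝ) (φ := fun _ : Fin (n + 1) => ℝ) a.succ)
      y := by
    rw [hasFDerivAt_pi]
    exact fun a => hasFDerivAt_apply a.succ y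
  have h := ((hasFDerivAt_apply (𝕜 := ℝ) (0 : Fin (n + 1)) y).add
    (hd.hasFDerivAt.comp y ht)).const_smul (1 / √2)
  refine Eq.trans ?_ h.fderiv.symm
  ext1 w
  obtain ⟨a, v, rfl⟩ : ∃ a v, w = Fin.cons a v := ⟨w 0, Fin.tail w, (Fin.cons_self_tail w).symm⟩
  change semiEuclid q (n + 1) ((1 / √2) • (Fin.cons (-1) (signedGrad q F (Fin.tail y)) :
    Fin (n + 1) → ℝ)) _ = _
  rw [map_smul, smul_apply, semiEuclid_cons hq, ← fderiv_eq_spatialForm]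
  simp only [smul_apply, add_apply, ContinuousLinearMap.proj_apply, Fin.cons_zero,
    ContinuousLinearMap.comp_apply]
  congr 2
  ring

theorem isClosedOneForm_rigForm (hq : 1 ≤ q) (hD : IsOpen D) (hF : ContDiffOn ℝ ∞ F D) :
    IsClosedOneForm D (rigForm q (mongeMap F) (mongeRig q F)) := by
  refine isClosedOneForm_of_eqOn_fderiv hD (hF.const_smul √2) fun p hp => ?_
  have hd := (hF.contDiffAt (hD.mem_nhds hp)).differentiableAt (by simp)
  ext1 v
  rw [rigForm_mongeMap hq hd]
  exact (congrArg (· v) (hd.hasFDerivAt.const_smul √2).fderiv.symm :)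

theorem hasConformalScreen_mongeRigged (hq : 1 ≤ q) (hD : IsOpen D) (hF : ContDiffOn ℝ ∞ F D)
    (hE : IsEikonal q D F) :
    HasConformalScreen q D (mongeMap F) (mongeRig q F) (mongeRigged q F) (fun _ => 1) where
  smooth := contDiffOn_const
  ne_zero _ _ := one_ne_zero
  eq p hp v := by
    have hF' := hF.contDiffAt (hD.mem_nhds hp)
    rw [one_smul, shapeN_mongeMap hF' (hE.eventually hD hp),
      shapeScreen_mongeMap hq hF' (hE.eventually hD hp)]

theorem isSemiRiemannianMetric_associatedMetric (hq : 1 ≤ q) (hD : IsOpen D)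
    (hF : ContDiffOn ℝ ∞ F D) (hE : IsEikonal q D F) :
    IsSemiRiemannianMetric D (associatedMetric q (mongeMap F) (mongeRig q F)) := by
  have hd : ∀ p ∈ D, DifferentiableAt ℝ F p := fun p hp =>
    (hF.contDiffAt (hD.mem_nhds hp)).differentiableAt (by simp)
  have hg : ∀ p ∈ D, ∀ v w, associatedMetric q (mongeMap F) (mongeRig q F) p v w =
      fderiv ℝ F p v * fderiv ℝ F p w + spatialForm q v w := fun p hp v w =>
    associatedMetric_mongeMap hq (hd p hp) v w
  refine ⟨fun v w => ?_, fun p hp v v' w => ?_, fun p hp c v w => ?_, fun p hp v w => ?_,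
    fun p hp v h => ?_⟩
  · refine ContDiffOn.congr (f := fun p => fderiv ℝ F p v * fderiv ℝ F p w + spatialForm q v w)
      ?_ fun p hp => hg p hp v w
    have hF' := hF.fderiv_of_isOpen (m := ∞) hD (by simp)
    exact ((hF'.clm_apply contDiffOn_const).mul (hF'.clm_apply contDiffOn_const)).add
      contDiffOn_const
  · rw [hg p hp, hg p hp, hg p hp, map_add, spatialForm_add_left]; ring
  · rw [hg p hp, hg p hp, map_smul, spatialForm_smul_left, smul_eq_mul]; ring
  · rw [hg p hp, hg p hp, spatialForm_comm, mul_comm]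
  · have hv : v = -fderiv ℝ F p v • signedGrad q F p := by
      ext a
      have := h (Pi.single a 1)
      rw [hg p hp, spatialForm_single] at this
      simp only [Pi.smul_apply, smul_eq_mul, signedGrad, pd]
      linear_combination semiSign q (a + 1) * this - v a * semiSign_mul_self q (a + 1)
    have h0 := congrArg (fderiv ℝ F p) hv
    rw [map_smul, hE p hp, smul_eq_mul, mul_one] at h0
    rw [hv, eq_zero_of_neg_eq h0.symm, neg_zero, zero_smul]

theorem inducedConn_mongeMap (hD : IsOpen D) (hF : ContDiffOn ℝ ∞ F D) (hE : IsEikonal q D F)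
    {Y : (Fin n → ℝ) → (Fin n → ℝ)} (hY : ContDiffOn ℝ ∞ Y D) (X : (Fin n → ℝ) → (Fin n → ℝ))
    {p : Fin n → ℝ} (hp : p ∈ D) :
    inducedConn (mongeMap F) (mongeRig q F) X Y p = fderiv ℝ Y p (X p) +
      (fderiv ℝ (fderiv ℝ F) p (X p) (Y p) / 2) • signedGrad q F p :=
  inducedCov_mongeMap (hF.contDiffAt (hD.mem_nhds hp)) (hE p hp)
    ((hY.contDiffAt (hD.mem_nhds hp)).differentiableAt (by simp)) _

theorem isAffineConnection_inducedConn (hD : IsOpen D) (hF : ContDiffOn ℝ ∞ F D)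
    (hE : IsEikonal q D F) :
    IsAffineConnection D (inducedConn (mongeMap F) (mongeRig q F)) where
  smooth X Y hX hY := by
    refine ContDiffOn.congr (f := fun p => fderiv ℝ Y p (X p) +
      (fderiv ℝ (fderiv ℝ F) p (X p) (Y p) / 2) • signedGrad q F p) ?_
      fun p hp => inducedConn_mongeMap hD hF hE hY X hp
    have hY' := hY.fderiv_of_isOpen (m := ∞) hD (by simp)
    have hF' := (hF.fderiv_of_isOpen (m := ∞) hD (by simp)).fderiv_of_isOpen (m := ∞) hD (by simp)
    exact (hY'.clm_apply hX).add ((((hF'.clm_apply hX).clm_apply hY).div_const 2).smul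
      (contDiffOn_signedGrad hD hF))
  add_left X X' Y _ _ hY p hp := by
    simp only [inducedConn_mongeMap hD hF hE hY _ hp, map_add, add_apply, add_div, add_smul]
    abel
  smul_left φ X Y _ _ hY p hp := by
    simp only [inducedConn_mongeMap hD hF hE hY _ hp, map_smul, smul_apply, smul_eq_mul, smul_add,
      mul_div_assoc, mul_smul]
  add_right X Y Y' _ hY hY' p hp := by
    have hd := (hY.contDiffAt (hD.mem_nhds hp)).differentiableAt (by simp)
    have hd' := (hY'.contDiffAt (hD.mem_nhds hp)).differentiableAt (by simp)
    rw [inducedConn_mongeMap hD hF hE (hY.add hY') X hp, inducedConn_mongeMap hD hF hE hY X hp,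
      inducedConn_mongeMap hD hF hE hY' X hp, fderiv_fun_add hd hd']
    simp only [map_add, add_apply, add_div, add_smul]
    abel
  leibniz φ X Y hφ _ hY p hp := by
    have hd := (hY.contDiffAt (hD.mem_nhds hp)).differentiableAt (by simp)
    have hd' := (hφ.contDiffAt (hD.mem_nhds hp)).differentiableAt (by simp)
    have hφY : ContDiffOn ℝ ∞ (fun u => φ u • Y u) D := hφ.smul hY
    rw [inducedConn_mongeMap hD hF hE hφY X hp, inducedConn_mongeMap hD hF hE hY X hp,
      fderiv_fun_smul hd' hd]
    simp only [map_smul, add_apply, smul_apply, ContinuousLinearMap.smulRight_apply, smul_eq_mul,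
      smul_add, mul_div_assoc, mul_smul]
    abel

theorem fderiv_spatialForm (q : ℕ) {Y Z : (Fin n → ℝ) → (Fin n → ℝ)} {p : Fin n → ℝ}
    (hY : DifferentiableAt ℝ Y p) (hZ : DifferentiableAt ℝ Z p) :
    DifferentiableAt ℝ (fun u => spatialForm q (Y u) (Z u)) p ∧ ∀ v : Fin n → ℝ,
      fderiv ℝ (fun u => spatialForm q (Y u) (Z u)) p v =
        spatialForm q (fderiv ℝ Y p v) (Z p) + spatialForm q (Y p) (fderiv ℝ Z p v) := by
  have h : HasFDerivAt (fun u => spatialForm q (Y u) (Z u)) _ p :=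
    HasFDerivAt.fun_sum (u := Finset.univ) fun (a : Fin n) _ =>
      ((hasFDerivAt_pi'.1 hY.hasFDerivAt a).mul (hasFDerivAt_pi'.1 hZ.hasFDerivAt a)).const_mul
        (semiSign q (a + 1))
  refine ⟨h.differentiableAt, fun v => ?_⟩
  rw [h.fderiv, spatialForm, spatialForm, ← Finset.sum_add_distrib, sum_apply]
  refine Finset.sum_congr rfl fun a _ => ?_
  simp only [smul_apply, add_apply, ContinuousLinearMap.comp_apply,
    ContinuousLinearMap.proj_apply, smul_eq_mul]
  ring

/-- Torsion vanishes by symmetry of the Hessian. For compatibility, `g_1(G, Z) = dF(G) dF(Z) + dF(Z)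
= 2 dF(Z)`, so the term `(Hess F(X, Y) / 2) G` contributes `Hess F(X, Y) dF(Z)`, exactly what
differentiating `dF(Y) dF(Z)` produces. -/
theorem isLeviCivita_inducedConn (hq : 1 ≤ q) (hD : IsOpen D) (hF : ContDiffOn ℝ ∞ F D)
    (hE : IsEikonal q D F) :
    IsLeviCivita D (associatedMetric q (mongeMap F) (mongeRig q F))
      (inducedConn (mongeMap F) (mongeRig q F)) where
  metric := isSemiRiemannianMetric_associatedMetric hq hD hF hE
  connection := isAffineConnection_inducedConn hD hF hE
  torsionFree X Y hX hY p hp := by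
    rw [inducedConn_mongeMap hD hF hE hY X hp, inducedConn_mongeMap hD hF hE hX Y hp,
      hessian_comm (hF.contDiffAt (hD.mem_nhds hp)) (X p), VectorField.lieBracket]
    abel
  compatible X Y Z hX hY hZ p hp := by
    have hF' := hF.contDiffAt (hD.mem_nhds hp)
    have hY' := (hY.contDiffAt (hD.mem_nhds hp)).differentiableAt (by simp)
    have hZ' := (hZ.contDiffAt (hD.mem_nhds hp)).differentiableAt (by simp)
    have hdF := hF'.fderiv_infty.differentiableAt (by simp)
    have h1 : (fun u => associatedMetric q (mongeMap F) (mongeRig q F) u (Y u) (Z u)) =ᶠ[nhds p]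
        fun u => fderiv ℝ F u (Y u) * fderiv ℝ F u (Z u) + spatialForm q (Y u) (Z u) :=
      hF'.eventually_differentiableAt_infty.mono fun u hu => associatedMetric_mongeMap hq hu _ _
    obtain ⟨hs, hs'⟩ := fderiv_spatialForm q hY' hZ'
    have hd := hF'.differentiableAt (by simp)
    have hfy := hdF.clm_apply hY'
    have hfz := hdF.clm_apply hZ'
    rw [h1.fderiv_eq, fderiv_fun_add (hfy.fun_mul hfz) hs, fderiv_fun_mul hfy hfz,
      inducedConn_mongeMap hD hF hE hY X hp, inducedConn_mongeMap hD hF hE hZ X hp,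
      associatedMetric_mongeMap hq hd, associatedMetric_mongeMap hq hd]
    simp only [add_apply, smul_apply, smul_eq_mul, fderiv_fderiv_apply hF' hY',
      fderiv_fderiv_apply hF' hZ', hs', map_add, map_smul, hE p hp, spatialForm_add_left,
      spatialForm_smul_left, spatialForm_comm q (Y p), ← fderiv_eq_spatialForm]
    ring

theorem mem_screen_mongeMap (hq : 1 ≤ q) {p : Fin n → ℝ} (hF : DifferentiableAt ℝ F p)
    {v : Fin n → ℝ} :
    v ∈ screen q (mongeMap F) (mongeRig q F) p ↔ fderiv ℝ F p v = 0 := by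
  change rigForm q (mongeMap F) (mongeRig q F) p v = 0 ↔ _
  rw [rigForm_mongeMap hq hF]
  simp

theorem isInvolutive_screen (hq : 1 ≤ q) (hD : IsOpen D) (hF : ContDiffOn ℝ ∞ F D) :
    IsInvolutive D (screen q (mongeMap F) (mongeRig q F)) := by
  have hd : ∀ p ∈ D, DifferentiableAt ℝ F p := fun p hp =>
    (hF.contDiffAt (hD.mem_nhds hp)).differentiableAt (by simp)
  -- For a section `Y` of the screen, `dF(Y) = 0` on `D`; differentiating this expresses `dF(D_v Y)`
  -- through the Hessian, whose symmetry then kills `dF([X, Y])`.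
  have key : ∀ Y : (Fin n → ℝ) → (Fin n → ℝ), ContDiffOn ℝ ∞ Y D →
      (∀ p ∈ D, Y p ∈ screen q (mongeMap F) (mongeRig q F) p) → ∀ p ∈ D, ∀ v,
      fderiv ℝ F p (fderiv ℝ Y p v) = -fderiv ℝ (fderiv ℝ F) p v (Y p) := by
    intro Y hY hYs p hp v
    have h := fderiv_fderiv_apply (hF.contDiffAt (hD.mem_nhds hp))
      ((hY.contDiffAt (hD.mem_nhds hp)).differentiableAt (by simp)) v
    have h0 : (fun u => fderiv ℝ F u (Y u)) =ᶠ[nhds p] fun _ => (0 : ℝ) := by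
      filter_upwards [hD.mem_nhds hp] with u hu
      exact (mem_screen_mongeMap hq (hd u hu)).1 (hYs u hu)
    rw [h0.fderiv_eq, fderiv_const_apply, zero_apply] at h
    linarith
  intro X Y hX hY hXs hYs p hp
  rw [mem_screen_mongeMap hq (hd p hp), VectorField.lieBracket, map_sub, key X hX hXs p hp,
    key Y hY hYs p hp, hessian_comm (hF.contDiffAt (hD.mem_nhds hp)), sub_self]

end Monge

/-! ### Flattening charts for the level sets of a submersion. -/

section LevelSets

variable {m : ℕ}

/-- A nonzero functional is completed to linear coordinates by the projection onto its kernel along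
a vector `v` with `T v = 1`. -/
theorem exists_injective_prod (T : (Fin m → ℝ) →L[ℝ] ℝ) (hT : T ≠ 0) :
    ∃ π : (Fin m → ℝ) →L[ℝ] EuclideanSpace ℝ (Fin (m - 1)), ∃ e : (Fin m → ℝ) ≃L[ℝ]
      ℝ × EuclideanSpace ℝ (Fin (m - 1)), (e : (Fin m → ℝ) →L[ℝ] _) = T.prod π := by
  obtain ⟨v, hv⟩ : ∃ v, T v = 1 := by
    obtain ⟨v, hv⟩ : ∃ v, T v ≠ 0 := by
      by_contra! h; exact hT (by ext1 v; simpa using h v)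
    exact ⟨(T v)⁻¹ • v, by simp [hv]⟩
  have hsurj : LinearMap.range T.toLinearMap = ⊤ := by
    rw [LinearMap.range_eq_top]
    exact fun c => ⟨c • v, by simp [hv]⟩
  -- Rank-nullity also yields `m ≥ 1`, which makes the truncated `m - 1` the true dimension of the
  -- kernel.
  have hrank := T.toLinearMap.finrank_range_add_finrank_ker
  rw [hsurj, finrank_top, Module.finrank_self, Module.finrank_fin_fun] at hrank
  have hker : Module.finrank ℝ (LinearMap.ker T.toLinearMap) =
      Module.finrank ℝ (EuclideanSpace ℝ (Fin (m - 1))) := by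
    rw [finrank_euclideanSpace_fin]; omega
  let ψ := LinearEquiv.ofFinrankEq _ _ hker
  let P : (Fin m → ℝ) →ₗ[ℝ] LinearMap.ker T.toLinearMap :=
    (LinearMap.id - T.toLinearMap.smulRight v).codRestrict _ (fun x => by simp [hv])
  let π : (Fin m → ℝ) →L[ℝ] EuclideanSpace ℝ (Fin (m - 1)) :=
    LinearMap.toContinuousLinearMap (ψ.toLinearMap ∘ₗ P)
  have hinj : Function.Injective (T.prod π).toLinearMap := by
    rw [injective_iff_map_eq_zero]
    intro x hx
    have h1 : T x = 0 := congrArg Prod.fst hx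
    have h2 : ψ (P x) = 0 := congrArg Prod.snd hx
    have h3 : x - T x • v = 0 := congrArg Subtype.val (ψ.map_eq_zero_iff.1 h2)
    simpa [h1] using h3
  have hfin : Module.finrank ℝ (Fin m → ℝ) =
      Module.finrank ℝ (ℝ × EuclideanSpace ℝ (Fin (m - 1))) := by
    rw [Module.finrank_prod, Module.finrank_self, finrank_euclideanSpace_fin,
      Module.finrank_fin_fun]
    omega
  exact ⟨π, (LinearEquiv.ofInjectiveOfFinrankEq _ hinj hfin).toContinuousLinearEquiv, rfl⟩

/-- A diffeomorphism between open sets of `D` and of `ℝ × ℝ^(m-1)` whose first component is `F`. -/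
structure IsFlattening (D : Set (Fin m → ℝ)) (F : (Fin m → ℝ) → ℝ)
    (Φ : OpenPartialHomeomorph (Fin m → ℝ) (ℝ × EuclideanSpace ℝ (Fin (m - 1)))) : Prop where
  source_subset : Φ.source ⊆ D
  fst_eq : ∀ x ∈ Φ.source, (Φ x).1 = F x
  contDiffOn : ContDiffOn ℝ ∞ Φ Φ.source
  contDiffOn_symm : ContDiffOn ℝ ∞ Φ.symm Φ.target

theorem exists_isFlattening {D : Set (Fin m → ℝ)} (hD : IsOpen D) {F : (Fin m → ℝ) → ℝ}
    (hF : ContDiffOn ℝ ∞ F D) {p : Fin m → ℝ} (hp : p ∈ D) (h : fderiv ℝ F p ≠ 0) :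
    ∃ Φ, IsFlattening D F Φ ∧ p ∈ Φ.source := by
  obtain ⟨π, e, he⟩ := exists_injective_prod _ h
  let f : (Fin m → ℝ) → ℝ × EuclideanSpace ℝ (Fin (m - 1)) := fun u => (F u, π u)
  have hf : ContDiffOn ℝ ∞ f D := hF.prodMk π.contDiff.contDiffOn
  have hf' : ∀ x ∈ D, HasFDerivAt f ((fderiv ℝ F x).prod π) x := fun x hx =>
    ((hF.contDiffAt (hD.mem_nhds hx)).differentiableAt (by simp)).hasFDerivAt.prodMk
      π.hasFDerivAt
  have hfp : HasFDerivAt f (e : (Fin m → ℝ) →L[ℝ] _) p := he ▸ hf' p hp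
  -- The inverse function theorem controls the derivative only at `p`; shrinking to the open set
  -- where it is invertible makes the local inverse smooth on its whole target.
  let s : Set (Fin m → ℝ) := D ∩ (fun u => (fderiv ℝ F u).prod π) ⁻¹' range
    ((↑) : ((Fin m → ℝ) ≃L[ℝ] ℝ × EuclideanSpace ℝ (Fin (m - 1))) → (Fin m → ℝ) →L[ℝ] _)
  have hs : IsOpen s := by
    refine ContinuousOn.isOpen_inter_preimage ?_ hD ContinuousLinearEquiv.isOpen
    have h1 := (hF.fderiv_of_isOpen (m := ∞) hD (by simp)).continuousOn
    exact (ContinuousLinearMap.prodₗᵢ (𝕜 := ℝ) (E := Fin m → ℝ) (F := ℝ)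
      (G := EuclideanSpace ℝ (Fin (m - 1))) ℝ).continuous.comp_continuousOn
        (h1.prodMk continuousOn_const)
  let Φ₀ := (hf.contDiffAt (hD.mem_nhds hp)).toOpenPartialHomeomorph f hfp (by simp)
  have hΦ₀ : ⇑Φ₀ = f := rfl
  refine ⟨Φ₀.restrOpen s hs, ⟨?_, ?_, ?_, ?_⟩, ?_⟩
  · intro x hx
    rw [OpenPartialHomeomorph.restrOpen_source] at hx
    exact hx.2.1
  · intro x _; rfl
  · refine hf.mono fun x hx => ?_
    rw [OpenPartialHomeomorph.restrOpen_source] at hx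
    exact hx.2.1
  · intro z hz
    have hx := (Φ₀.restrOpen s hs).map_target hz
    rw [OpenPartialHomeomorph.restrOpen_source] at hx
    obtain ⟨e', he'⟩ := hx.2.2
    refine ((Φ₀.restrOpen s hs).contDiffAt_symm (f₀' := e') hz ?_ ?_).contDiffWithinAt
    · rw [he']; exact hf' _ hx.2.1
    · exact hf.contDiffAt (hD.mem_nhds hx.2.1)
  · rw [OpenPartialHomeomorph.restrOpen_source]
    exact ⟨ContDiffAt.mem_toOpenPartialHomeomorph_source _ hfp _, hp, e, he⟩

variable {D : Set (Fin m → ℝ)} {F : (Fin m → ℝ) → ℝ} {c : ℝ}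
  {Φ : OpenPartialHomeomorph (Fin m → ℝ) (ℝ × EuclideanSpace ℝ (Fin (m - 1)))}

theorem IsFlattening.symm_mem (h : IsFlattening D F Φ) {z : EuclideanSpace ℝ (Fin (m - 1))}
    (hz : (c, z) ∈ Φ.target) : Φ.symm (c, z) ∈ {u | u ∈ D ∧ F u = c} :=
  ⟨h.source_subset (Φ.map_target hz), by rw [← h.fst_eq _ (Φ.map_target hz), Φ.right_inv hz]⟩

theorem IsFlattening.apply_eq (h : IsFlattening D F Φ) {x : Fin m → ℝ} (hx : x ∈ Φ.source)
    (hc : F x = c) : (c, (Φ x).2) = Φ x := by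
  rw [← hc, ← h.fst_eq x hx]

open Classical in
/-- The chart of a level set of `F` given by a flattening. -/
noncomputable def levelChart (h : IsFlattening D F Φ) (x₀ : {u | u ∈ D ∧ F u = c}) :
    OpenPartialHomeomorph {u | u ∈ D ∧ F u = c} (EuclideanSpace ℝ (Fin (m - 1))) where
  -- The base point `x₀` is only a default value of the inverse outside the target.
  toFun x := (Φ x).2
  invFun z := if hz : (c, z) ∈ Φ.target then ⟨Φ.symm (c, z), h.symm_mem hz⟩ else x₀
  source := Subtype.val ⁻¹' Φ.source
  target := Prod.mk c ⁻¹' Φ.target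
  map_source' x hx := by
    rw [mem_preimage, h.apply_eq hx x.2.2]; exact Φ.map_source hx
  map_target' z hz := by
    rw [mem_preimage] at hz
    simp only [hz, dif_pos, mem_preimage]
    exact Φ.map_target hz
  left_inv' x hx := by
    have : (c, (Φ x).2) ∈ Φ.target := by rw [h.apply_eq hx x.2.2]; exact Φ.map_source hx
    rw [dif_pos this]
    ext1
    change Φ.symm (c, (Φ x).2) = x
    rw [h.apply_eq hx x.2.2, Φ.left_inv hx]
  right_inv' z hz := by
    rw [mem_preimage] at hz
    rw [dif_pos hz]
    change (Φ (Φ.symm (c, z))).2 = z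
    rw [Φ.right_inv hz]
  open_source := Φ.open_source.preimage continuous_subtype_val
  open_target := Φ.open_target.preimage (by fun_prop)
  continuousOn_toFun := continuous_snd.comp_continuousOn
    (Φ.continuousOn.comp continuous_subtype_val.continuousOn fun _ h => h)
  continuousOn_invFun := by
    rw [Topology.IsInducing.subtypeVal.continuousOn_iff]
    refine ContinuousOn.congr (f := fun z => Φ.symm (c, z))
      (Φ.continuousOn_symm.comp (by fun_prop) fun _ h => h) fun z hz => ?_
    rw [mem_preimage] at hz
    simp [hz]

theorem levelChart_apply (h : IsFlattening D F Φ) (x₀ x : {u | u ∈ D ∧ F u = c}) :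
    levelChart h x₀ x = (Φ x).2 := rfl

theorem levelChart_target (h : IsFlattening D F Φ) (x₀ : {u | u ∈ D ∧ F u = c}) :
    (levelChart h x₀).target = Prod.mk c ⁻¹' Φ.target := rfl

theorem levelChart_symm_apply (h : IsFlattening D F Φ) (x₀ : {u | u ∈ D ∧ F u = c})
    {z : EuclideanSpace ℝ (Fin (m - 1))} (hz : z ∈ (levelChart h x₀).target) :
    ((levelChart h x₀).symm z : Fin m → ℝ) = Φ.symm (c, z) := by
  rw [levelChart_target, mem_preimage] at hz
  exact congrArg Subtype.val (dif_pos hz)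

theorem IsFlattening.contDiffOn_slice (h : IsFlattening D F Φ) :
    ContDiffOn ℝ ∞ (fun z => Φ.symm (c, z)) (Prod.mk c ⁻¹' Φ.target) :=
  h.contDiffOn_symm.comp (contDiff_const.prodMk contDiff_id).contDiffOn fun _ h => h

/-- The slice of a flattening parametrizes the kernel of the differential of `F`. -/
theorem IsFlattening.fderiv_slice (h : IsFlattening D F Φ) {x : Fin m → ℝ} (hx : x ∈ Φ.source)
    (hc : F x = c) :
    Function.Injective (fderiv ℝ (fun z => Φ.symm (c, z)) (Φ x).2) ∧
      ∀ w, fderiv ℝ F x w = 0 ↔ ∃ v, fderiv ℝ (fun z => Φ.symm (c, z)) (Φ x).2 v = w := by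
  have hA := ((h.contDiffOn.contDiffAt (Φ.open_source.mem_nhds hx)).differentiableAt
    (by simp)).hasFDerivAt
  have hB := ((h.contDiffOn_symm.contDiffAt (Φ.open_target.mem_nhds
    (Φ.map_source hx))).differentiableAt (by simp)).hasFDerivAt
  have hBA : (fderiv ℝ Φ.symm (Φ x)).comp (fderiv ℝ Φ x) = .id ℝ _ :=
    (hB.comp x hA).unique ((hasFDerivAt_id x).congr_of_eventuallyEq
      (Φ.eventually_left_inverse hx))
  have hAB : (fderiv ℝ Φ x).comp (fderiv ℝ Φ.symm (Φ x)) = .id ℝ _ := by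
    have hA' : HasFDerivAt Φ (fderiv ℝ Φ x) (Φ.symm (Φ x)) := by rwa [Φ.left_inv hx]
    exact (hA'.comp _ hB).unique ((hasFDerivAt_id _).congr_of_eventuallyEq
      (Φ.eventually_right_inverse (Φ.map_source hx)))
  -- In flattened coordinates `dF` is the first projection, so its kernel corresponds to the vectors
  -- `(0, v)`.
  have hF : ∀ w, (fderiv ℝ Φ x w).1 = fderiv ℝ F x w := by
    intro w
    have h1 : F =ᶠ[nhds x] fun u => (Φ u).1 := by
      filter_upwards [Φ.open_source.mem_nhds hx] with u hu using (h.fst_eq u hu).symm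
    rw [h1.fderiv_eq, hA.fst.fderiv]; rfl
  have hγ : ∀ v, fderiv ℝ (fun z => Φ.symm (c, z)) (Φ x).2 v =
      fderiv ℝ Φ.symm (Φ x) (0, v) := by
    intro v
    have hB' : HasFDerivAt Φ.symm (fderiv ℝ Φ.symm (Φ x)) (c, (Φ x).2) := by
      rwa [h.apply_eq hx hc]
    have := hB'.comp (Φ x).2 ((hasFDerivAt_const c _).prodMk (hasFDerivAt_id (Φ x).2))
    change HasFDerivAt (fun z => Φ.symm (c, z)) _ _ at this
    rw [this.fderiv]; rfl
  have hAB' : ∀ v, fderiv ℝ Φ x (fderiv ℝ Φ.symm (Φ x) v) = v := fun v => congrArg (· v) hAB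
  have hBA' : ∀ v, fderiv ℝ Φ.symm (Φ x) (fderiv ℝ Φ x v) = v := fun v => congrArg (· v) hBA
  refine ⟨fun v v' hv => ?_, fun w => ⟨fun hw => ⟨(fderiv ℝ Φ x w).2, ?_⟩, ?_⟩⟩
  · rw [hγ, hγ] at hv
    have := congrArg (fderiv ℝ Φ x) hv
    rw [hAB', hAB'] at this
    exact congrArg Prod.snd this
  · rw [hγ, ← hw, ← hF, Prod.mk.eta, hBA']
  · rintro ⟨v, rfl⟩
    rw [hγ, ← hF, hAB']

end LevelSets

/-! ### Integral manifolds and leaves of `ker dF`. -/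

section LevelSetManifolds

variable {m : ℕ} {D : Set (Fin m → ℝ)} {F : (Fin m → ℝ) → ℝ}
  {S : (Fin m → ℝ) → Submodule ℝ (Fin m → ℝ)}

/-- The charts are slices of flattenings. A transition map is a slice of one inverse flattening
followed by the second component of another, hence smooth. -/
theorem isEmbeddedIntegralManifold_levelSet (hD : IsOpen D) (hF : ContDiffOn ℝ ∞ F D)
    (hreg : ∀ p ∈ D, fderiv ℝ F p ≠ 0) (hS : ∀ p ∈ D, ∀ w, w ∈ S p ↔ fderiv ℝ F p w = 0) (c : ℝ) :
    IsEmbeddedIntegralManifold D S (m - 1) {u | u ∈ D ∧ F u = c} := by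
  choose Φ hΦ hmem using fun p : {u | u ∈ D ∧ F u = c} =>
    exists_isFlattening hD hF p.2.1 (hreg p p.2.1)
  let cs : ChartedSpace (EuclideanSpace ℝ (Fin (m - 1))) {u | u ∈ D ∧ F u = c} :=
    { atlas := range fun p => levelChart (hΦ p) p
      chartAt := fun p => levelChart (hΦ p) p
      mem_chart_source := hmem
      chart_mem_atlas := mem_range_self }
  have hman : IsManifold (𝓡 (m - 1)) ∞ {u | u ∈ D ∧ F u = c} := by
    refine isManifold_of_contDiffOn _ _ _ ?_
    rintro _ _ ⟨p, rfl⟩ ⟨p', rfl⟩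
    simp only [modelWithCornersSelf_coe, modelWithCornersSelf_coe_symm, Function.id_comp,
      Function.comp_id, preimage_id, range_id, inter_univ, OpenPartialHomeomorph.coe_trans]
    intro z hz
    rw [OpenPartialHomeomorph.trans_source] at hz
    have hz1 : z ∈ (levelChart (hΦ p) p).target := hz.1
    have hz2 : (Φ p).symm (c, z) ∈ (Φ p').source := by
      rw [← levelChart_symm_apply (hΦ p) p hz1]; exact hz.2
    have h1 := ((hΦ p).contDiffOn_slice (c := c)).contDiffAt
      ((levelChart (hΦ p) p).open_target.mem_nhds hz1)
    have h2 := ((hΦ p').contDiffOn.contDiffAt ((Φ p').open_source.mem_nhds hz2)).snd.comp z h1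
    refine (h2.congr_of_eventuallyEq ?_).contDiffWithinAt
    filter_upwards [(levelChart (hΦ p) p).open_target.mem_nhds hz1] with y hy
    rw [Function.comp_apply, levelChart_apply, levelChart_symm_apply _ _ hy]
    rfl
  have hlocal : ∀ x : {u | u ∈ D ∧ F u = c},
      (fun z => ((levelChart (hΦ x) x).symm z : Fin m → ℝ)) =ᶠ[nhds (levelChart (hΦ x) x x)]
        fun z => (Φ x).symm (c, z) := by
    intro x
    filter_upwards [(levelChart (hΦ x) x).open_target.mem_nhds
      ((levelChart (hΦ x) x).map_source (hmem x))] with z hz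
    exact levelChart_symm_apply _ _ hz
  have hsmooth : ContMDiff (𝓡 (m - 1)) 𝓘(ℝ, Fin m → ℝ) ∞
      (Subtype.val : {u | u ∈ D ∧ F u = c} → Fin m → ℝ) := by
    intro x
    rw [contMDiffAt_iff]
    refine ⟨continuous_subtype_val.continuousAt, ?_⟩
    have h1 := ((hΦ x).contDiffOn_slice (c := c)).contDiffAt
      ((levelChart (hΦ x) x).open_target.mem_nhds ((levelChart (hΦ x) x).map_source (hmem x)))
    exact (h1.congr_of_eventuallyEq (hlocal x)).contDiffWithinAt
  have hderiv : ∀ x : {u | u ∈ D ∧ F u = c},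
      mfderiv (𝓡 (m - 1)) 𝓘(ℝ, Fin m → ℝ) (Subtype.val : {u | u ∈ D ∧ F u = c} → Fin m → ℝ) x =
        fderiv ℝ (fun z => (Φ x).symm (c, z)) (Φ x x).2 := by
    intro x
    have h : fderivWithin ℝ (writtenInExtChartAt (𝓡 (m - 1)) 𝓘(ℝ, Fin m → ℝ) x
        (Subtype.val : {u | u ∈ D ∧ F u = c} → Fin m → ℝ)) (range (𝓡 (m - 1)))
        (extChartAt (𝓡 (m - 1)) x x) = fderiv ℝ (fun z => (Φ x).symm (c, z)) (Φ x x).2 := by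
      rw [modelWithCornersSelf_coe, range_id, fderivWithin_univ]
      exact (hlocal x).fderiv_eq
    exact ((hsmooth x).mdifferentiableAt (by simp)).mfderiv.trans h
  refine ⟨{u | u ∈ D ∧ F u = c}, inferInstance, inferInstance, inferInstance, cs, hman,
    Subtype.val, ⟨hsmooth, Subtype.val_injective, fun y => y.2.1, fun y => ?_, fun y w => ?_⟩,
    Topology.IsEmbedding.subtypeVal, Subtype.range_coe⟩
  · rw [hderiv y]
    exact ((hΦ y).fderiv_slice (hmem y) y.2.2).1
  · rw [hderiv y, hS y y.2.1]
    exact ((hΦ y).fderiv_slice (hmem y) y.2.2).2 w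

theorem IsEmbeddedIntegralManifold.mono {D' L : Set (Fin m → ℝ)} {k : ℕ} (h : D' ⊆ D)
    (hL : IsEmbeddedIntegralManifold D' S k L) : IsEmbeddedIntegralManifold D S k L := by
  obtain ⟨P, i1, i2, i3, i4, i5, ι, hι, he, hr⟩ := hL
  exact ⟨P, i1, i2, i3, i4, i5, ι, ⟨hι.smooth, hι.injective, fun y => h (hι.mem y), hι.immersion,
    hι.tangent⟩, he, hr⟩

theorem IsEmbeddedIntegralManifold.locallyConnectedSpace {L : Set (Fin m → ℝ)} {k : ℕ}
    (hL : IsEmbeddedIntegralManifold D S k L) : LocallyConnectedSpace L := by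
  obtain ⟨P, i1, i2, i3, i4, i5, ι, hι, he, rfl⟩ := hL
  have : LocallyConnectedSpace P := ChartedSpace.locallyConnectedSpace (EuclideanSpace ℝ (Fin k)) P
  exact he.toHomeomorph.symm.locallyConnectedSpace

theorem IsEmbeddedIntegralManifold.isConnectedIntegralManifold {L : Set (Fin m → ℝ)} {k : ℕ}
    (hL : IsEmbeddedIntegralManifold D S k L) (hc : IsConnected L) :
    IsConnectedIntegralManifold D S k L := by
  obtain ⟨P, i1, i2, i3, i4, i5, ι, hι, he, rfl⟩ := hL
  have : ConnectedSpace P := by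
    have := isConnected_iff_connectedSpace.1 hc
    exact he.toHomeomorph.symm.surjective.connectedSpace he.toHomeomorph.symm.continuous
  exact ⟨P, i1, i2, i3, this, i4, i5, ι, hι, rfl⟩

/-- A level set is locally connected, so its components are relatively open. A component is thus a
full level set of `F` on a smaller open set `D ∩ U`, to which the embedded result applies. -/
theorem isConnectedIntegralManifold_component (hD : IsOpen D) (hF : ContDiffOn ℝ ∞ F D)
    (hreg : ∀ p ∈ D, fderiv ℝ F p ≠ 0) (hS : ∀ p ∈ D, ∀ w, w ∈ S p ↔ fderiv ℝ F p w = 0)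
    {p : Fin m → ℝ} (hp : p ∈ D) : IsConnectedIntegralManifold D S (m - 1)
      (connectedComponentIn {u | u ∈ D ∧ F u = F p} p) := by
  have hpL : p ∈ {u | u ∈ D ∧ F u = F p} := ⟨hp, rfl⟩
  have := (isEmbeddedIntegralManifold_levelSet hD hF hreg hS (F p)).locallyConnectedSpace
  obtain ⟨U, hU, hUc⟩ := isOpen_induced_iff.1
    (isOpen_connectedComponent (x := (⟨p, hpL⟩ : {u | u ∈ D ∧ F u = F p})))
  have heq : connectedComponentIn {u | u ∈ D ∧ F u = F p} p =
      {u | u ∈ D ∩ U ∧ F u = F p} := by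
    rw [connectedComponentIn_eq_image hpL, ← hUc, Subtype.image_preimage_coe]
    ext u
    simp only [mem_inter_iff, mem_ofPred_eq]
    tauto
  refine IsEmbeddedIntegralManifold.isConnectedIntegralManifold ?_
    (isConnected_connectedComponentIn_iff.2 hpL)
  rw [heq]
  exact (isEmbeddedIntegralManifold_levelSet (hD.inter hU) (hF.mono inter_subset_left)
    (fun p hp => hreg p hp.1) (fun p hp => hS p hp.1) (F p)).mono inter_subset_left

/-- A function on a manifold with vanishing differential is locally constant. -/
theorem isLocallyConstant_of_mfderiv_eq_zero {k : ℕ} {P : Type*} [TopologicalSpace P]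
    [ChartedSpace (EuclideanSpace ℝ (Fin k)) P] [IsManifold (𝓡 k) ∞ P] {g : P → ℝ}
    (hg : MDifferentiable (𝓡 k) 𝓘(ℝ, ℝ) g) (h : ∀ y, mfderiv (𝓡 k) 𝓘(ℝ, ℝ) g y = 0) :
    IsLocallyConstant g := by
  rw [IsLocallyConstant.iff_eventually_eq]
  intro y
  set φ := chartAt (EuclideanSpace ℝ (Fin k)) y with hφ
  have : IsManifold (𝓡 k) 1 P := IsManifold.of_le (n := ∞) (by norm_cast)
  have hderiv : ∀ z ∈ φ.target, HasFDerivAt (g ∘ φ.symm) (0 : _ →L[ℝ] ℝ) z := by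
    intro z hz
    have h1 := (mdifferentiableAt_atlas_symm (I := 𝓡 k)
      (chart_mem_atlas (EuclideanSpace ℝ (Fin k)) y) hz).hasMFDerivAt
    have h2 := (hg (φ.symm z)).hasMFDerivAt.comp z h1
    rw [h, ContinuousLinearMap.zero_comp] at h2
    exact h2.hasFDerivAt
  have hy : φ y ∈ φ.target := φ.map_source (mem_chart_source _ y)
  obtain ⟨r, hr, hball⟩ := Metric.isOpen_iff.1 φ.open_target _ hy
  have hconst : ∀ z ∈ Metric.ball (φ y) r, (g ∘ φ.symm) z = (g ∘ φ.symm) (φ y) := by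
    intro z hz
    refine (convex_ball (φ y) r).is_const_of_fderivWithin_eq_zero (𝕜 := ℝ)
      (fun w hw => (hderiv w (hball hw)).differentiableAt.differentiableWithinAt)
      (fun w hw => ?_) hz (Metric.mem_ball_self hr)
    rw [fderivWithin_of_isOpen Metric.isOpen_ball hw, (hderiv w (hball hw)).fderiv]
  have hcont := φ.continuousAt (mem_chart_source _ y)
  filter_upwards [hcont (Metric.ball_mem_nhds _ hr),
    φ.open_source.mem_nhds (mem_chart_source _ y)] with x hx hxs
  have := hconst _ hx
  rwa [Function.comp_apply, Function.comp_apply, φ.left_inv hxs,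
    φ.left_inv (mem_chart_source _ y)] at this

/-- Tangent vectors of the integral manifold lie in `ker dF`, so `F ∘ ι` is locally constant, hence
constant; its connected image stays in one component. -/
theorem IsConnectedIntegralManifold.subset_component (hD : IsOpen D) (hF : ContDiffOn ℝ ∞ F D)
    (hS : ∀ p ∈ D, ∀ w, w ∈ S p ↔ fderiv ℝ F p w = 0) {k : ℕ} {L : Set (Fin m → ℝ)}
    (hL : IsConnectedIntegralManifold D S k L) {p : Fin m → ℝ} (hp : p ∈ L) :
    p ∈ D ∧ L ⊆ connectedComponentIn {u | u ∈ D ∧ F u = F p} p := by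
  obtain ⟨P, i1, i2, i3, i4, i5, i6, ι, hι, rfl⟩ := hL
  have hd : ∀ y, HasMFDerivAt (𝓡 k) 𝓘(ℝ, ℝ) (F ∘ ι) y
      ((fderiv ℝ F (ι y)).comp (mfderiv (𝓡 k) 𝓘(ℝ, Fin m → ℝ) ι y)) := fun y =>
    ((hF.contDiffAt (hD.mem_nhds (hι.mem y))).differentiableAt
      (by simp)).hasFDerivAt.hasMFDerivAt.comp y
        ((hι.smooth y).mdifferentiableAt (by simp)).hasMFDerivAt
  have hconst : IsLocallyConstant (F ∘ ι) := by
    refine isLocallyConstant_of_mfderiv_eq_zero (fun y => (hd y).mdifferentiableAt) fun y => ?_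
    rw [(hd y).mfderiv]
    ext v
    exact (hS _ (hι.mem y) _).1 ((hι.tangent y _).2 ⟨v, rfl⟩)
  obtain ⟨y, rfl⟩ := hp
  refine ⟨hι.mem y, (isPreconnected_range hι.smooth.continuous).subset_connectedComponentIn
    (mem_range_self y) ?_⟩
  rintro _ ⟨y', rfl⟩
  exact ⟨hι.mem y', hconst.apply_eq_of_preconnectedSpace y' y⟩

theorem isLeaf_iff_eq_component (hD : IsOpen D) (hF : ContDiffOn ℝ ∞ F D)
    (hreg : ∀ p ∈ D, fderiv ℝ F p ≠ 0) (hS : ∀ p ∈ D, ∀ w, w ∈ S p ↔ fderiv ℝ F p w = 0)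
    (L : Set (Fin m → ℝ)) : IsLeaf D S (m - 1) L ↔
      ∃ p ∈ D, L = connectedComponentIn {u | u ∈ D ∧ F u = F p} p := by
  constructor
  · rintro ⟨hL, hmax⟩
    have hne : L.Nonempty := by
      obtain ⟨P, _, _, _, _, _, _, ι, _, rfl⟩ := hL
      exact range_nonempty ι
    obtain ⟨p, hp⟩ := hne
    obtain ⟨hpD, hsub⟩ := hL.subset_component hD hF hS hp
    exact ⟨p, hpD, (hmax _ (isConnectedIntegralManifold_component hD hF hreg hS hpD) hsub).symm⟩
  · rintro ⟨p, hp, rfl⟩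
    refine ⟨isConnectedIntegralManifold_component hD hF hreg hS hp, fun L' hL' hsub => ?_⟩
    exact (hL'.subset_component hD hF hS (hsub (mem_connectedComponentIn ⟨hp, rfl⟩))).2.antisymm
      hsub

theorem isIntegrable_of_mem_iff (hD : IsOpen D) (hF : ContDiffOn ℝ ∞ F D)
    (hreg : ∀ p ∈ D, fderiv ℝ F p ≠ 0) (hS : ∀ p ∈ D, ∀ w, w ∈ S p ↔ fderiv ℝ F p w = 0) :
    IsIntegrable D S (m - 1) := fun p hp =>
  ⟨_, mem_connectedComponentIn (F := {u | u ∈ D ∧ F u = F p}) ⟨hp, rfl⟩,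
    isConnectedIntegralManifold_component hD hF hreg hS hp⟩

end LevelSetManifolds

/-! ### Assembly of the main theorem. -/

theorem mainTheorem10 (n q : ℕ) (hq : 1 ≤ q) (hqn : q ≤ n + 1) (D : Set (Fin n → ℝ))
    (hD : IsOpen D) (F : (Fin n → ℝ) → ℝ) (hF : ContDiffOn ℝ ∞ F D)
    (hnull : IsNullHypersurface q D (mongeMap F)) :
    -- the vector field is a null rigging, with the stated rigged vector field
    (IsNullRigging q D (mongeMap F) {y | Fin.tail y ∈ D} (mongeRigging q F) ∧
      IsRiggedField q D (mongeMap F) (mongeRig q F) (mongeRigged q F) ∧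
      (∀ p ∈ D, fderiv ℝ (mongeMap F) p (mongeRigged q F p) =
        (1 / √2) • (Fin.cons 1 (fun a : Fin n => semiSign q (a + 1) * pd F a p) :
          Fin (n + 1) → ℝ))) ∧
    -- the rigging is closed (on `ℝ × D` and along the hypersurface) and `τ` vanishes
    (IsClosedOneForm {y | Fin.tail y ∈ D} (flatForm q (mongeRigging q F)) ∧
      IsClosedOneForm D (rigForm q (mongeMap F) (mongeRig q F)) ∧
      ∀ p ∈ D, ∀ v, rotationForm q (mongeMap F) (mongeRig q F) (mongeRigged q F) p v = 0) ∧
    -- the screen is conformal with factor one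
    HasConformalScreen q D (mongeMap F) (mongeRig q F) (mongeRigged q F) (fun _ => 1) ∧
    -- the screen is integrable, every level set of `F` is an embedded integral hypersurface, and
    -- the leaves are the connected components of the level sets
    (IsInvolutive D (screen q (mongeMap F) (mongeRig q F)) ∧
      IsIntegrable D (screen q (mongeMap F) (mongeRig q F)) (n - 1) ∧
      (∀ c : ℝ, IsEmbeddedIntegralManifold D (screen q (mongeMap F) (mongeRig q F)) (n - 1)
        {u | u ∈ D ∧ F u = c}) ∧
      ∀ L : Set (Fin n → ℝ), IsLeaf D (screen q (mongeMap F) (mongeRig q F)) (n - 1) L ↔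
        ∃ p ∈ D, L = connectedComponentIn {u | u ∈ D ∧ F u = F p} p) ∧
    -- the induced connection is the Levi-Civita connection of the associated metric
    IsLeviCivita D (associatedMetric q (mongeMap F) (mongeRig q F))
      (inducedConn (mongeMap F) (mongeRig q F)) ∧
    -- the divergence in the natural basis
    (∀ X : (Fin n → ℝ) → (Fin n → ℝ), ContDiffOn ℝ ∞ X D → ∀ p ∈ D,
      inducedDiv (mongeMap F) (mongeRig q F) X p = ∑ a : Fin n, pd (fun u => X u a) a p) := by
  have hE := hnull.isEikonal hq hD hF
  have hd : ∀ p ∈ D, DifferentiableAt ℝ F p := fun p hp =>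
    (hF.contDiffAt (hD.mem_nhds hp)).differentiableAt (by simp)
  -- The eikonal equation makes every point of `D` regular. In particular `n ≥ 1` unless `D` is
  -- empty, so the truncation in `n - 1` is harmless.
  have hreg : ∀ p ∈ D, fderiv ℝ F p ≠ 0 := fun p hp h0 => by
    have := hE p hp
    simp [h0] at this
  have hS : ∀ p ∈ D, ∀ w, w ∈ screen q (mongeMap F) (mongeRig q F) p ↔ fderiv ℝ F p w = 0 :=
    fun p hp w => mem_screen_mongeMap hq (hd p hp)
  refine ⟨⟨isNullRigging_mongeRigging hq hD hF hE, isRiggedField_mongeRigged hq hD hF hE,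
    fun p hp => fderiv_mongeMap_mongeRigged (hd p hp) (hE p hp)⟩,
    ⟨isClosedOneForm_flatForm hq hD hF, isClosedOneForm_rigForm hq hD hF, fun p hp v =>
      rotationForm_mongeMap hq (hF.contDiffAt (hD.mem_nhds hp)) (hE.eventually hD hp) v⟩,
    hasConformalScreen_mongeRigged hq hD hF hE,
    ⟨isInvolutive_screen hq hD hF, isIntegrable_of_mem_iff hD hF hreg hS,
      isEmbeddedIntegralManifold_levelSet hD hF hreg hS,
      isLeaf_iff_eq_component hD hF hreg hS⟩,
    isLeviCivita_inducedConn hq hD hF hE, fun X hX p hp => ?_⟩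
  exact inducedDiv_mongeMap (hF.contDiffAt (hD.mem_nhds hp)) (hE.eventually hD hp)
    ((hX.contDiffAt (hD.mem_nhds hp)).differentiableAt (by simp))
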